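/- For a graph $H$ and a positive integer $n$, let $\mathbf{N}_{\mathcal P}(n,H)$ denote the maximum, over all planar graphs $G$ on $n$ vertices, of the number of (unlabeled) copies of $H$ in $G$, that is, of the number of subgraphs of $G$ isomorphic to $H$. All graphs are simple, and $C_k$ denotes the cycle on $k$ vertices. Then, as $n\to\infty$, \[ \mathbf{N}_{\mathcal P}(n,C_6)=\Bigl(\frac n3\Bigr)^3+O\bigl(n^{3-1/5}\bigr),\qquad \mathbf{N}_{\mathcal P}(n,C_8)=\Bigl(\frac n4\Bigr)^4+O\bigl(n^{4-1/5}\bigr), \] and, for every integer $m\ge 5$, \[ \mathbf{N}_{\mathcal P}(n,C_{2m})\le \frac{n^m}{m!}+O\bigl(n^{m-1/5}\bigr), \] where the implied constant may depend on $m$. -/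

import Mathlib

/-- The Euclidean plane. -/
abbrev Plane : Type := EuclideanSpace ℝ (Fin 2)

/-- A drawing of `G` in the plane without crossings: vertices are distinct points, every edge is a
simple arc (an injective continuous image of `[0, 1]`) joining the points of its two end vertices,
an arc contains no vertex point except at its two ends, and two different arcs meet only in vertex
points (hence only in common end points). -/
structure PlaneDrawing {V : Type*} (G : SimpleGraph V) where
  point : V → Plane
  arc : G.edgeSet → C(unitInterval, Plane)
  point_injective : Function.Injective point
  arc_injective : ∀ e, Function.Injective (arc e)
  arc_ends : ∀ e, s(arc e 0, arc e 1) = (e : Sym2 V).map point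
  eq_end_of_arc_eq_point : ∀ e t v, arc e t = point v → t = 0 ∨ t = 1
  exists_point_of_arc_eq_arc : ∀ e f s t, e ≠ f → arc e s = arc f t → ∃ v, arc e s = point v

/-- A graph is planar if it can be drawn in the plane without crossings. -/
def IsPlanar {V : Type*} (G : SimpleGraph V) : Prop := Nonempty (PlaneDrawing G)

open Classical in
/-- The maximum number of (unlabelled) copies of `H` in a planar graph on `n` vertices. Up to
isomorphism every `n`-vertex graph is a graph on `Fin n`, so the maximum is over a finite set. This
set contains the edgeless graph, so it is not empty. -/
noncomputable def maxPlanarCopies {W : Type*} (n : ℕ) (H : SimpleGraph W) : ℕ :=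
  (Finset.univ.filter fun G : SimpleGraph (Fin n) => IsPlanar G).sup fun G => G.copyCount H

/-!
The theorem compares `2m`-cycles in a planar graph `G` on `n` vertices with weighted `m`-cycles.

*Reduction.* Let `S` be the set of vertices of degree at most `n ^ (1/5)`. A planar graph has `O(n)`
edges, so that `Sᶜ` has `O(n ^ (4/5))` vertices. A `2m`-cycle has a perfect matching; hence there
are `O(n ^ m)` of them; the count drops to `O(n ^ (m - 1/5))` for those which contain an edge inside
`S` (two consecutive vertices cost only a bounded degree each) or an edge from a fixed set of
`O(n ^ (4/5))` edges. The latter applies to the edges inside `Sᶜ` together with the vertices of `S`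
that have at least three neighbours in `Sᶜ`, since there are only `O(|Sᶜ|)` of these
(`IsDrawable.card_le_of_three_nbrs`). The remaining cycles alternate between `Sᶜ` and `S`, and
their `m` vertices in `S` determine them: each has exactly two neighbours in `Sᶜ`, and these pairs
form an `m`-cycle (`exists_cycle_transversals`). In particular there are at most `n.choose m` of
them, which is the bound for `m ≥ 5`.

*Optimisation.* If `w e` is the number of vertices in `S` with neighbourhood `e` in `Sᶜ`, then the
remaining cycles number at most the sum over all `m`-cycles of the products of the weights of their
edges. For `m = 3, 4` this polynomial is at most `(∑ w / m) ^ m`. At a maximum point on the simplex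
the sum over the cycles through a given edge of positive weight, with that weight left out, is at
least `m` times the maximum (`lagrangePoly_le`); for an edge of maximal weight this sum is bounded
directly (`lagrangeLink_triangle_le`, `lagrangeLink_fourCycle_le`).

*Planarity.* Only the following consequence of planarity is used: edges without a common end can be
drawn as disjoint curves (`IsDrawable`). This property passes to contractions. It fails for
`K₃,₃` by van Kampen's parity argument, for which continuous logarithms of differences of points on
two disjoint curves replace the counting of crossings (`not_disjoint_drawing_K33`). Linear edge
bounds follow from the exclusion of `K₆` by Mader's contraction argument (`ConeSparse.step`).

*Lower bound.* Replace each edge of an `m`-cycle by about `n / m` paths of length two, and draw the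
result with straight lines (`isPlanar_blowUpCycle`, `pow_le_copyCount_blowUpCycle`).
-/

/-! ### Continuous logarithms and the nonplanarity of `K₃,₃` -/

section

/-- A continuous logarithm of a constant function is constant. -/
theorem eq_of_exp_eq_const {h : ℝ → ℂ} (hc : Continuous h) {c : ℂ}
    (he : ∀ t, Complex.exp (h t) = c) (s t : ℝ) : h s = h t := by
  have := Complex.isCoveringMap_exp.eq_of_comp_eq (g₁ := h) (g₂ := fun _ => h s) hc
    continuous_const (by ext x; simp [he]) s rfl
  exact (congrFun this t).symm

/-- A nowhere vanishing continuous function on `ℝ × ℝ` has a continuous logarithm. -/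
theorem exists_continuous_log {g : ℝ × ℝ → ℂ} (hg : Continuous g) (h0 : ∀ x, g x ≠ 0) :
    ∃ f : ℝ × ℝ → ℂ, Continuous f ∧ ∀ x, Complex.exp (f x) = g x := by
  have hU : IsSimplyConnected (Set.univ : Set (ℝ × ℝ)) := by
    have : SimplyConnectedSpace (Set.univ : Set (ℝ × ℝ)) :=
      (Homeomorph.Set.univ (ℝ × ℝ)).toHomotopyEquiv.simplyConnectedSpace_iff.2 inferInstance
    exact this
  obtain ⟨f, hf, he⟩ := Complex.exists_continuousOn_eqOn_exp_comp hU isOpen_univ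
    hg.continuousOn (by simpa using h0)
  exact ⟨f, continuousOn_univ.1 hf, fun x => he (Set.mem_univ x)⟩

open Complex in
/-- The edges `u u'` and `v v'` are drawn as disjoint curves `γ` and `δ`, and `A`, `A'`, `B`, `B'`
are logarithms of `γ - v`, `γ - v'`, `δ - u`, `δ - u'`. The difference `γ s - δ t` does not vanish
on the square, so that the changes of its argument along the four sides cancel. -/
theorem log_increments_of_disjoint {γ δ : ℝ → ℂ} (hγ : Continuous γ) (hδ : Continuous δ)
    (hne : ∀ s t, γ s ≠ δ t) {A A' B B' : ℝ → ℂ} (hA : Continuous A) (hA' : Continuous A')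
    (hB : Continuous B) (hB' : Continuous B')
    (eA : ∀ s, exp (A s) = γ s - δ 0) (eA' : ∀ s, exp (A' s) = γ s - δ 1)
    (eB : ∀ t, exp (B t) = δ t - γ 0) (eB' : ∀ t, exp (B' t) = δ t - γ 1) :
    (A 1 - A 0) + (B' 1 - B' 0) = (A' 1 - A' 0) + (B 1 - B 0) := by
  obtain ⟨f, hf, he⟩ := exists_continuous_log (g := fun x => γ x.1 - δ x.2) (by fun_prop)
    (fun x => sub_ne_zero.2 (hne _ _))
  have key : ∀ (g F : ℝ → ℂ), Continuous g → Continuous F → ∀ c : ℂ,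
      (∀ t, exp (g t) = c * exp (F t)) → g 1 - g 0 = F 1 - F 0 := by
    intro g F hg hF c h
    have := eq_of_exp_eq_const (h := fun t => g t - F t) (by fun_prop) (c := c)
      (fun t => by rw [exp_sub, h, mul_div_cancel_right₀ _ (exp_ne_zero _)]) 1 0
    linear_combination this
  have h1 := key (fun s => f (s, 0)) A (by fun_prop) hA 1 (fun s => by simp [he, eA])
  have h2 := key (fun s => f (s, 1)) A' (by fun_prop) hA' 1 (fun s => by simp [he, eA'])
  have h3 := key (fun s => f (0, s)) B (by fun_prop) hB (-1) (fun s => by simp [he, eB])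
  have h4 := key (fun s => f (1, s)) B' (by fun_prop) hB' (-1) (fun s => by simp [he, eB'])
  linear_combination h2 + h3 - h1 - h4

/-- The van Kampen parity argument: in a drawing of `K₃,₃` some two edges without a common end
vertex meet. The curves may be arbitrary otherwise. -/
theorem not_disjoint_drawing_K33 (a b : Fin 3 → ℂ) (K : Fin 3 → Fin 3 → Set ℂ)
    (hJ : ∀ i j, JoinedIn (K i j) (a i) (b j))
    (hd : ∀ i i' j j', i ≠ i' → j ≠ j' → Disjoint (K i j) (K i' j')) : False := by
  classical
  have hdn : ∀ {i i' j j'} {z w : ℂ}, i ≠ i' → j ≠ j' → z ∈ K i j → w ∈ K i' j' → z ≠ w := by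
    rintro i i' j j' z w h h' hz hw rfl
    exact Set.disjoint_left.1 (hd i i' j j' h h') hz hw
  have hother : ∀ i : Fin 3, ∃ j, j ≠ i := by decide
  have hma : ∀ i j, a i ∈ K i j := fun i j => (hJ i j).source_mem
  have hmb : ∀ i j, b j ∈ K i j := fun i j => (hJ i j).target_mem
  choose γ hγc hγ using fun i j => show ∃ γ : ℝ → ℂ, Continuous γ ∧
      (γ 0 = a i ∧ γ 1 = b j ∧ ∀ t, γ t ∈ K i j) from
    ⟨(hJ i j).somePath.extend, (hJ i j).somePath.continuous_extend, by simp, by simp,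
      fun t => (hJ i j).somePath_mem _⟩
  have hγ0 : ∀ i j, γ i j 0 = a i := fun i j => (hγ i j).1
  have hγ1 : ∀ i j, γ i j 1 = b j := fun i j => (hγ i j).2.1
  have hγm : ∀ i j t, γ i j t ∈ K i j := fun i j => (hγ i j).2.2
  have lift : ∀ (δ : ℝ → ℂ), Continuous δ → (∀ t, δ t ≠ 0) →
      ∃ f : ℝ → ℂ, Continuous f ∧ ∀ t, Complex.exp (f t) = δ t := by
    intro δ hδ h0
    obtain ⟨f, hf, he⟩ := exists_continuous_log (g := fun x => δ x.1) (by fun_prop) (fun x => h0 _)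
    exact ⟨fun t => f (t, 0), by fun_prop, fun t => he _⟩
  -- logarithms along an edge, seen from a vertex outside that edge
  have hA : ∀ i j i', i ≠ i' → ∀ t, γ i j t - a i' ≠ 0 := by
    intro i j i' h t
    obtain ⟨j', hj'⟩ := hother j
    exact sub_ne_zero.2 (hdn h hj'.symm (hγm i j t) (hma i' j'))
  have hB : ∀ i j j', j ≠ j' → ∀ t, γ i j t - b j' ≠ 0 := by
    intro i j j' h t
    obtain ⟨i', hi'⟩ := hother i
    exact sub_ne_zero.2 (hdn hi'.symm h (hγm i j t) (hmb i' j'))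
  have hA' : ∀ i j i', ∃ f : ℝ → ℂ, Continuous f ∧
      (i ≠ i' → ∀ t, Complex.exp (f t) = γ i j t - a i') := by
    intro i j i'
    by_cases h : i ≠ i'
    · obtain ⟨f, hf, he⟩ := lift (fun t => γ i j t - a i') ((hγc i j).sub continuous_const)
        (hA i j i' h)
      exact ⟨f, hf, fun _ => he⟩
    · exact ⟨fun _ => 0, continuous_const, fun h' => absurd h' h⟩
  have hB' : ∀ i j j', ∃ f : ℝ → ℂ, Continuous f ∧
      (j ≠ j' → ∀ t, Complex.exp (f t) = γ i j t - b j') := by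
    intro i j j'
    by_cases h : j ≠ j'
    · obtain ⟨f, hf, he⟩ := lift (fun t => γ i j t - b j') ((hγc i j).sub continuous_const)
        (hB i j j' h)
      exact ⟨f, hf, fun _ => he⟩
    · exact ⟨fun _ => 0, continuous_const, fun h' => absurd h' h⟩
  choose fA fAc fAe using hA'
  choose fB fBc fBe using hB'
  -- logarithms of the differences of vertices, the smaller vertex minus the larger one
  let θa : Fin 3 → Fin 3 → ℂ := fun i i' => Complex.log (a i - a i')
  let θb : Fin 3 → Fin 3 → ℂ := fun j j' => Complex.log (b j - b j')
  let θ : Fin 3 → Fin 3 → ℂ := fun i j => Complex.log (a i - b j)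
  have eθa : ∀ i i', i ≠ i' → Complex.exp (θa i i') = a i - a i' := by
    intro i i' h
    refine Complex.exp_log ?_
    have := hA i 0 i' h 0
    rwa [hγ0] at this
  have eθb : ∀ j j', j ≠ j' → Complex.exp (θb j j') = b j - b j' := by
    intro i i' h
    refine Complex.exp_log ?_
    have := hB 0 i i' h 1
    rwa [hγ1] at this
  have eθ : ∀ i j, Complex.exp (θ i j) = a i - b j := by
    intro i j
    refine Complex.exp_log ?_
    obtain ⟨j', hj'⟩ := hother j
    have := hB i j' j hj' 0
    rwa [hγ0] at this
  let πi : ℂ := Real.pi * Complex.I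
  have eπ : Complex.exp πi = -1 := Complex.exp_pi_mul_I
  let ηa : Fin 3 → Fin 3 → ℂ := fun i i' => if i < i' then θa i i' else θa i' i + πi
  let ηb : Fin 3 → Fin 3 → ℂ := fun i i' => if i < i' then θb i i' else θb i' i + πi
  have eηa : ∀ i i', i ≠ i' → Complex.exp (ηa i i') = a i - a i' := by
    intro i i' h
    by_cases hl : i < i'
    · simp only [ηa, if_pos hl, eθa i i' h]
    · simp only [ηa, if_neg hl, Complex.exp_add, eθa i' i h.symm, eπ]; ring
  have eηb : ∀ i i', i ≠ i' → Complex.exp (ηb i i') = b i - b i' := by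
    intro i i' h
    by_cases hl : i < i'
    · simp only [ηb, if_pos hl, eθb i i' h]
    · simp only [ηb, if_neg hl, Complex.exp_add, eθb i' i h.symm, eπ]; ring
  have hint : ∀ (f : ℝ → ℂ) (x y : ℂ), Complex.exp (f 0) = Complex.exp x →
      Complex.exp (f 1) = Complex.exp y → ∃ n : ℤ, f 1 - f 0 = y - x + n * (2 * πi) := by
    intro f x y h0 h1
    obtain ⟨n, hn⟩ := Complex.exp_eq_exp_iff_exists_int.1 h0
    obtain ⟨k, hk⟩ := Complex.exp_eq_exp_iff_exists_int.1 h1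
    refine ⟨k - n, ?_⟩
    simp only [πi]
    push_cast
    linear_combination hk - hn
  have hNA : ∀ i j i', ∃ n : ℤ, i ≠ i' →
      fA i j i' 1 - fA i j i' 0 = (θ i' j + πi) - ηa i i' + n * (2 * πi) := by
    intro i j i'
    by_cases h : i ≠ i'
    · obtain ⟨n, hn⟩ := hint (fA i j i') (ηa i i') (θ i' j + πi)
        (by rw [fAe i j i' h, eηa i i' h, hγ0])
        (by rw [fAe i j i' h, Complex.exp_add, eθ, hγ1, eπ]; ring)
      exact ⟨n, fun _ => hn⟩
    · exact ⟨0, fun h' => absurd h' h⟩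
  have hNB : ∀ i j j', ∃ n : ℤ, j ≠ j' →
      fB i j j' 1 - fB i j j' 0 = ηb j j' - θ i j' + n * (2 * πi) := by
    intro i j j'
    by_cases h : j ≠ j'
    · obtain ⟨n, hn⟩ := hint (fB i j j') (θ i j') (ηb j j')
        (by rw [fBe i j j' h, eθ, hγ0])
        (by rw [fBe i j j' h, eηb j j' h, hγ1])
      exact ⟨n, fun _ => hn⟩
    · exact ⟨0, fun h' => absurd h' h⟩
  choose NA hNA using hNA
  choose NB hNB using hNB
  have π0 : πi ≠ 0 := by
    intro h
    rw [h, Complex.exp_zero] at eπ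
    norm_num at eπ
  -- each pair of independent edges gives one linear equation between the integers
  have main : ∀ i i' j j', i < i' → j ≠ j' →
      NA i j i' + NB i' j' j - NA i' j' i - NB i j j' = if j < j' then -1 else 0 := by
    intro i i' j j' hi hj
    have h := log_increments_of_disjoint (hγc i j) (hγc i' j')
      (fun s t => hdn hi.ne hj (hγm i j s) (hγm i' j' t))
      (fAc i j i') (fBc i j j') (fAc i' j' i) (fBc i' j' j)
      (fun s => by rw [hγ0]; exact fAe i j i' hi.ne s)
      (fun s => by rw [hγ1]; exact fBe i j j' hj s)
      (fun s => by rw [hγ0]; exact fAe i' j' i hi.ne' s)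
      (fun s => by rw [hγ1]; exact fBe i' j' j hj.symm s)
    rw [hNA i j i' hi.ne, hNA i' j' i hi.ne', hNB i j j' hj, hNB i' j' j hj.symm] at h
    have ha : ηa i' i = ηa i i' + πi := by simp [ηa, hi, hi.le]
    have hb : ηb j' j = ηb j j' + (if j < j' then πi else -πi) := by
      rcases lt_or_gt_of_ne hj with h | h
      · simp [ηb, h, h.le]
      · simp [ηb, h, h.not_gt]
    rw [ha, hb] at h
    have h2 : ((NA i j i' + NB i' j' j - NA i' j' i - NB i j j' : ℤ) : ℂ) * (2 * πi)
        = ((if j < j' then -1 else 0 : ℤ) : ℂ) * (2 * πi) := by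
      split_ifs at h ⊢
      all_goals
        push_cast
        linear_combination h
    exact_mod_cast mul_right_cancel₀ (mul_ne_zero two_ne_zero π0) h2
  have e1 := main 0 1 0 1 (by decide) (by decide)
  have e2 := main 0 1 0 2 (by decide) (by decide)
  have e3 := main 0 1 1 0 (by decide) (by decide)
  have e4 := main 0 1 1 2 (by decide) (by decide)
  have e5 := main 0 1 2 0 (by decide) (by decide)
  have e6 := main 0 1 2 1 (by decide) (by decide)
  have f1 := main 0 2 0 1 (by decide) (by decide)
  have f2 := main 0 2 0 2 (by decide) (by decide)
  have f3 := main 0 2 1 0 (by decide) (by decide)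
  have f4 := main 0 2 1 2 (by decide) (by decide)
  have f5 := main 0 2 2 0 (by decide) (by decide)
  have f6 := main 0 2 2 1 (by decide) (by decide)
  have g1 := main 1 2 0 1 (by decide) (by decide)
  have g2 := main 1 2 0 2 (by decide) (by decide)
  have g3 := main 1 2 1 0 (by decide) (by decide)
  have g4 := main 1 2 1 2 (by decide) (by decide)
  have g5 := main 1 2 2 0 (by decide) (by decide)
  have g6 := main 1 2 2 1 (by decide) (by decide)
  -- every integer occurs in exactly two of the 18 equations, while the right-hand sides add up to `-9`
  simp at e1 e2 e3 e4 e5 e6 f1 f2 f3 f4 f5 f6 g1 g2 g3 g4 g5 g6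
  omega

end

/-! ### Drawable graphs and edge contraction -/

section

variable {V : Type*}

/-- A weak form of planarity that is inherited by minors: the edges can be drawn as curves in the
plane so that two edges without a common end vertex are disjoint. The curve of the edge `u v` is
recorded by the set `K u v` in which it runs. Curves may cross themselves, and edges with a common
end vertex may meet anywhere. -/
def IsDrawable (G : SimpleGraph V) : Prop :=
  ∃ (p : V → ℂ) (K : V → V → Set ℂ), (∀ u v, G.Adj u v → JoinedIn (K u v) (p u) (p v)) ∧
    ∀ u v x y, G.Adj u v → G.Adj x y → u ≠ x → u ≠ y → v ≠ x → v ≠ y → Disjoint (K u v) (K x y)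

theorem IsPlanar.isDrawable {G : SimpleGraph V} (h : IsPlanar G) : IsDrawable G := by
  classical
  obtain ⟨D⟩ := h
  let e := Complex.orthonormalBasisOneI.repr.symm
  refine ⟨fun v => e (D.point v), fun u v => {z | ∃ (h : G.Adj u v) (t : unitInterval),
    z = e (D.arc ⟨s(u, v), h⟩ t)}, ?_, ?_⟩
  · intro u v h
    set E : G.edgeSet := ⟨s(u, v), h⟩ with hE
    have hJ : JoinedIn {z | ∃ (h : G.Adj u v) (t : unitInterval), z = e (D.arc ⟨s(u, v), h⟩ t)}
        (e (D.arc E 0)) (e (D.arc E 1)) :=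
      ⟨⟨⟨fun t => e (D.arc E t), by fun_prop⟩, rfl, rfl⟩, fun t => ⟨h, t, rfl⟩⟩
    have := D.arc_ends E
    simp only [hE, Sym2.map_mk, Sym2.eq_iff] at this
    rcases this with ⟨h0, h1⟩ | ⟨h0, h1⟩
    · rw [← hE] at h0 h1
      rwa [h0, h1] at hJ
    · rw [← hE] at h0 h1
      rw [h0, h1] at hJ
      exact hJ.symm
  · intro u v x y h h' h1 h2 h3 h4
    have hend : ∀ (a b : V) (hab : G.Adj a b) (t : unitInterval) (w : V),
        D.arc ⟨s(a, b), hab⟩ t = D.point w → w = a ∨ w = b := by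
      intro a b hab t w hw
      have hends := D.arc_ends ⟨s(a, b), hab⟩
      simp only [Sym2.map_mk, Sym2.eq_iff] at hends
      rcases D.eq_end_of_arc_eq_point _ _ _ hw with rfl | rfl <;>
      rcases hends with ⟨e0, e1⟩ | ⟨e0, e1⟩ <;>
      first
        | exact Or.inl (D.point_injective (hw.symm.trans e0))
        | exact Or.inr (D.point_injective (hw.symm.trans e0))
        | exact Or.inl (D.point_injective (hw.symm.trans e1))
        | exact Or.inr (D.point_injective (hw.symm.trans e1))
    rw [Set.disjoint_left]
    rintro z ⟨_, s, rfl⟩ ⟨_, t, ht⟩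
    have ht := e.injective ht
    obtain ⟨w, hw⟩ := D.exists_point_of_arc_eq_arc ⟨s(u, v), h⟩ ⟨s(x, y), h'⟩ s t
      (fun hE => by
        have := congrArg Subtype.val hE
        simp only [Sym2.eq_iff] at this
        tauto) ht
    have w1 := hend u v h s w hw
    have w2 := hend x y h' t w (ht ▸ hw)
    rcases w1 with rfl | rfl <;> rcases w2 with rfl | rfl <;> tauto

theorem IsDrawable.not_K33 {G : SimpleGraph V} (h : IsDrawable G) {a b : Fin 3 → V}
    (ha : Function.Injective a) (hb : Function.Injective b) (hab : ∀ i j, G.Adj (a i) (b j)) :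
    False := by
  obtain ⟨p, K, hK, hd⟩ := h
  refine not_disjoint_drawing_K33 (fun i => p (a i)) (fun j => p (b j)) (fun i j => K (a i) (b j))
    (fun i j => hK _ _ (hab i j)) (fun i i' j j' hi hj => hd _ _ _ _ (hab i j) (hab i' j')
      (ha.ne hi) (hab i j').ne (hab i' j).ne' (hb.ne hj))

theorem IsDrawable.not_K6 {G : SimpleGraph V} (h : IsDrawable G) {Q : Finset V}
    (hQ : Q.card = 6) (hc : ∀ x ∈ Q, ∀ y ∈ Q, x ≠ y → G.Adj x y) : False := by
  let e : Fin 6 ≃ Q := (Q.equivFinOfCardEq hQ).symm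
  refine h.not_K33 (a := fun i => e (Fin.castAdd 3 i)) (b := fun j => e (Fin.natAdd 3 j)) ?_ ?_ ?_
  · exact Subtype.val_injective.comp (e.injective.comp (Fin.castAdd_injective 3 3))
  · exact Subtype.val_injective.comp (e.injective.comp (Fin.natAdd_injective 3 3))
  · intro i j
    refine hc _ (e _).2 _ (e _).2 ?_
    rw [Ne, Subtype.val_inj, e.apply_eq_iff_eq, Fin.ext_iff]
    simp only [Fin.val_castAdd, Fin.val_natAdd]
    omega

/-- The contraction of the edge `u v` into its end `v`. The vertex set stays the same, with `u`
becoming isolated. -/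
def SimpleGraph.contractInto (G : SimpleGraph V) (u v : V) : SimpleGraph V where
  Adj x y := x ≠ u ∧ y ≠ u ∧
    (G.Adj x y ∨ (x = v ∧ y ≠ v ∧ G.Adj u y) ∨ (y = v ∧ x ≠ v ∧ G.Adj u x))
  symm := ⟨fun _ _ ⟨h1, h2, h3⟩ => ⟨h2, h1, h3.imp SimpleGraph.Adj.symm Or.symm⟩⟩
  loopless := ⟨fun x ⟨_, _, h⟩ => by
    rcases h with h | h | h
    · exact G.loopless.irrefl x h
    · exact h.2.1 h.1
    · exact h.2.1 h.1⟩

theorem IsDrawable.contractInto {G : SimpleGraph V} (h : IsDrawable G) {u v : V}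
    (huv : G.Adj u v) : IsDrawable (G.contractInto u v) := by
  classical
  obtain ⟨p, K, hK, hd⟩ := h
  -- a new edge at `v` first follows the edge `v u`
  let K' : V → V → Set ℂ := fun x y => if G.Adj x y then K x y else
    if x = v then K v u ∪ K u y else K x u ∪ K u v
  have piece : ∀ x y, (G.contractInto u v).Adj x y → ∀ z ∈ K' x y, ∃ r s, G.Adj r s ∧ z ∈ K r s ∧
      (r = x ∨ r = y ∨ (r = u ∧ (x = v ∨ y = v))) ∧
      (s = x ∨ s = y ∨ (s = u ∧ (x = v ∨ y = v))) := by
    rintro x y ⟨hx, hy, hxy⟩ z hz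
    simp only [K'] at hz
    split_ifs at hz with h1 h2
    · exact ⟨x, y, h1, hz, by simp, by simp⟩
    · subst h2
      have huy : G.Adj u y := by tauto
      rcases hz with hz | hz
      · exact ⟨x, u, huv.symm, hz, by simp, by simp⟩
      · exact ⟨u, y, huy, hz, by simp, by simp⟩
    · have hy : y = v := by tauto
      have hux : G.Adj u x := by tauto
      rcases hz with hz | hz
      · exact ⟨x, u, hux.symm, hz, by simp, by simp [hy]⟩
      · exact ⟨u, v, huv, hz, by simp [hy], by simp [hy]⟩
  refine ⟨p, K', ?_, ?_⟩
  · rintro x y ⟨hx, hy, hxy⟩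
    simp only [K']
    split_ifs with h1 h2
    · exact hK _ _ h1
    · subst h2
      have huy : G.Adj u y := by tauto
      exact ((hK _ _ huv.symm).mono Set.subset_union_left).trans
        ((hK _ _ huy).mono Set.subset_union_right)
    · have hy : y = v := by tauto
      have hux : G.Adj u x := by tauto
      subst hy
      exact ((hK _ _ hux.symm).mono Set.subset_union_left).trans
        ((hK _ _ huv).mono Set.subset_union_right)
  · intro a b x y hab hxy h1 h2 h3 h4
    rw [Set.disjoint_left]
    intro z hz hz'
    obtain ⟨r, s, hrs, hz, hr, hs⟩ := piece a b hab z hz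
    obtain ⟨r', s', hrs', hz', hr', hs'⟩ := piece x y hxy z hz'
    obtain ⟨ha, hb, -⟩ := hab
    obtain ⟨hx, hy, -⟩ := hxy
    have sep : ∀ q q', (q = a ∨ q = b ∨ (q = u ∧ (a = v ∨ b = v))) →
        (q' = x ∨ q' = y ∨ (q' = u ∧ (x = v ∨ y = v))) → q ≠ q' := by
      intro q q' hq hq' e
      subst e
      rcases hq with rfl | rfl | ⟨rfl, rfl | rfl⟩ <;> rcases hq' with h | h | ⟨h, h' | h'⟩ <;>
        first | exact h1 h | exact h2 h | exact h3 h | exact h4 h | exact ha h | exact hb h |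
          exact hx h.symm | exact hy h.symm | exact h1 h'.symm | exact h2 h'.symm |
          exact h3 h'.symm | exact h4 h'.symm
    exact Set.disjoint_left.1 (hd r s r' s' hrs hrs' (sep _ _ hr hr') (sep _ _ hr hs')
      (sep _ _ hs hr') (sep _ _ hs hs')) hz hz'

end

/-! ### Drawable graphs are sparse -/

section

variable {V : Type*}

open Classical in
/-- The ordered pairs of adjacent vertices of `S`, that is, the darts of the subgraph induced on
`S`. -/
noncomputable def SimpleGraph.dartsIn (G : SimpleGraph V) (S : Finset V) : Finset (V × V) :=
  (S ×ˢ S).filter fun x => G.Adj x.1 x.2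

open Classical in
/-- The neighbours of `v` in `S`. -/
noncomputable def SimpleGraph.nbrsIn (G : SimpleGraph V) (S : Finset V) (v : V) : Finset V :=
  S.filter fun x => G.Adj v x

theorem SimpleGraph.mem_dartsIn {G : SimpleGraph V} {S : Finset V} {x : V × V} :
    x ∈ G.dartsIn S ↔ x.1 ∈ S ∧ x.2 ∈ S ∧ G.Adj x.1 x.2 := by
  simp [SimpleGraph.dartsIn, and_assoc]

theorem SimpleGraph.mem_nbrsIn {G : SimpleGraph V} {S : Finset V} {v x : V} :
    x ∈ G.nbrsIn S v ↔ x ∈ S ∧ G.Adj v x := by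
  simp [SimpleGraph.nbrsIn]

theorem SimpleGraph.card_dartsIn (G : SimpleGraph V) (S : Finset V) :
    (G.dartsIn S).card = ∑ v ∈ S, (G.nbrsIn S v).card := by
  classical
  rw [SimpleGraph.dartsIn, Finset.card_filter, Finset.sum_product]
  refine Finset.sum_congr rfl fun v _ => ?_
  rw [SimpleGraph.nbrsIn, Finset.card_filter]

open Classical in
/-- Contracting `u v` destroys the edge `u v` and, for each common neighbour of `u` and `v`, one of
its two edges to `u` and `v`. -/
theorem SimpleGraph.card_dartsIn_contractInto (G : SimpleGraph V) {S : Finset V} {u v : V}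
    (hu : u ∈ S) (hv : v ∈ S) (huv : G.Adj u v) :
    (G.dartsIn S).card ≤ ((G.contractInto u v).dartsIn (S.erase u)).card + 2
      + 2 * (G.nbrsIn S u ∩ G.nbrsIn S v).card := by
  set N := G.nbrsIn S u
  set P := (N \ G.nbrsIn S v).erase v
  -- the darts at `u`
  have h1 : (G.dartsIn S).card ≤ (G.dartsIn (S.erase u)).card + 2 * N.card := by
    have : G.dartsIn S ⊆ G.dartsIn (S.erase u) ∪ (N.image (fun y => (u, y)) ∪
        N.image (fun y => (y, u))) := by
      rintro ⟨x, y⟩ h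
      rw [mem_dartsIn] at h
      simp only [Finset.mem_union, mem_dartsIn, Finset.mem_image, N, mem_nbrsIn, Finset.mem_erase,
        Prod.mk.injEq]
      by_cases hx : x = u
      · subst hx
        exact Or.inr (Or.inl ⟨y, ⟨h.2.1, h.2.2⟩, rfl, rfl⟩)
      · by_cases hy : y = u
        · subst hy
          exact Or.inr (Or.inr ⟨x, ⟨h.1, h.2.2.symm⟩, rfl, rfl⟩)
        · exact Or.inl ⟨⟨hx, h.1⟩, ⟨hy, h.2.1⟩, h.2.2⟩
    have := Finset.card_le_card this
    have := Finset.card_union_le (G.dartsIn (S.erase u)) (N.image (fun y => (u, y)) ∪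
        N.image (fun y => (y, u)))
    have := Finset.card_union_le (N.image (fun y => (u, y))) (N.image (fun y => (y, u)))
    have := Finset.card_image_le (s := N) (f := fun y => (u, y))
    have := Finset.card_image_le (s := N) (f := fun y => (y, u))
    omega
  have h2 : N.card ≤ P.card + 1 + (N ∩ G.nbrsIn S v).card := by
    have := Finset.card_inter_add_card_sdiff N (G.nbrsIn S v)
    have := Finset.pred_card_le_card_erase (s := N \ G.nbrsIn S v) (a := v)
    simp only [P]
    omega
  have hP : ∀ y ∈ P, y ≠ v ∧ y ∈ S ∧ G.Adj u y ∧ ¬ G.Adj v y := by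
    intro y hy
    simp only [P, N, Finset.mem_erase, Finset.mem_sdiff, mem_nbrsIn] at hy
    tauto
  have h3 : (G.dartsIn (S.erase u)).card + 2 * P.card
      ≤ ((G.contractInto u v).dartsIn (S.erase u)).card := by
    have d1 : Disjoint (P.image (fun y => (v, y))) (P.image (fun y => (y, v))) := by
      rw [Finset.disjoint_left]
      rintro ⟨x, y⟩ h h'
      simp only [Finset.mem_image, Prod.mk.injEq] at h h'
      obtain ⟨a, ha, rfl, rfl⟩ := h
      obtain ⟨b, hb, rfl, rfl⟩ := h'
      exact (hP _ hb).1 rfl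
    have d2 : Disjoint (G.dartsIn (S.erase u)) (P.image (fun y => (v, y)) ∪
        P.image (fun y => (y, v))) := by
      rw [Finset.disjoint_left]
      rintro ⟨x, y⟩ h h'
      simp only [Finset.mem_union, Finset.mem_image, Prod.mk.injEq, mem_dartsIn] at h h'
      rcases h' with ⟨a, ha, rfl, rfl⟩ | ⟨a, ha, rfl, rfl⟩
      · exact (hP _ ha).2.2.2 h.2.2
      · exact (hP _ ha).2.2.2 h.2.2.symm
    have hsub : G.dartsIn (S.erase u) ∪ (P.image (fun y => (v, y)) ∪ P.image (fun y => (y, v)))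
        ⊆ (G.contractInto u v).dartsIn (S.erase u) := by
      rintro ⟨x, y⟩ h
      simp only [Finset.mem_union, Finset.mem_image, Prod.mk.injEq, mem_dartsIn,
        Finset.mem_erase] at h ⊢
      rcases h with h | ⟨a, ha, rfl, rfl⟩ | ⟨a, ha, rfl, rfl⟩
      · exact ⟨h.1, h.2.1, h.1.1, h.2.1.1, Or.inl h.2.2⟩
      · obtain ⟨p1, p2, p3, p4⟩ := hP _ ha
        exact ⟨⟨huv.ne', hv⟩, ⟨p3.ne', p2⟩, huv.ne', p3.ne', Or.inr (Or.inl ⟨rfl, p1, p3⟩)⟩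
      · obtain ⟨p1, p2, p3, p4⟩ := hP _ ha
        exact ⟨⟨p3.ne', p2⟩, ⟨huv.ne', hv⟩, p3.ne', huv.ne', Or.inr (Or.inr ⟨rfl, p1, p3⟩)⟩
    have := Finset.card_le_card hsub
    rw [Finset.card_union_of_disjoint d2, Finset.card_union_of_disjoint d1,
      Finset.card_image_of_injective _ (fun a b h => (Prod.mk.inj h).2),
      Finset.card_image_of_injective _ (fun a b h => (Prod.mk.inj h).1)] at this
    omega
  omega

/-- `S` has at most `c * |S|` edges whenever it is completely joined to a clique of `i` vertices in
some drawable graph. -/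
def ConeSparse (V : Type*) (i c : ℕ) : Prop :=
  ∀ G : SimpleGraph V, IsDrawable G → ∀ A S : Finset V, A.card = i →
    (∀ x ∈ A, ∀ y ∈ A, x ≠ y → G.Adj x y) → (∀ x ∈ A, ∀ y ∈ S, G.Adj x y) →
    (G.dartsIn S).card ≤ 2 * c * S.card

theorem coneSparse_four_zero : ConeSparse V 4 0 := by
  classical
  intro G hG A S hA hc hAS
  simp only [mul_zero, zero_mul, nonpos_iff_eq_zero, Finset.card_eq_zero]
  by_contra hne
  obtain ⟨⟨x, y⟩, hxy⟩ := Finset.nonempty_iff_ne_empty.2 hne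
  obtain ⟨hx, hy, hxy⟩ := SimpleGraph.mem_dartsIn.1 hxy
  simp only at hx hy hxy
  have hxA : x ∉ A := fun h => (hAS x h x hx).ne rfl
  have hyA : y ∉ A := fun h => (hAS y h y hy).ne rfl
  refine hG.not_K6 (Q := insert x (insert y A)) ?_ ?_
  · rw [Finset.card_insert_of_notMem (by simp [hxA, hxy.ne]), Finset.card_insert_of_notMem hyA, hA]
  · intro a ha b hb hab
    simp only [Finset.mem_insert] at ha hb
    rcases ha with rfl | rfl | ha <;> rcases hb with rfl | rfl | hb
    · exact absurd rfl hab
    · exact hxy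
    · exact (hAS _ hb _ hx).symm
    · exact hxy.symm
    · exact absurd rfl hab
    · exact (hAS _ hb _ hy).symm
    · exact hAS _ ha _ hx
    · exact hAS _ ha _ hy
    · exact hc _ ha _ hb hab

/-- Mader's argument. An edge with few common neighbours of its ends is contracted. If there is
none, then the neighbourhood of a vertex, which is joined to one more clique vertex, is dense. -/
theorem ConeSparse.step {i c : ℕ} (h : ConeSparse V (i + 1) c) : ConeSparse V i (2 * c + 1) := by
  classical
  intro G hG A S hA hc hAS
  induction hn : S.card generalizing G S with
  | zero => simp [SimpleGraph.dartsIn, Finset.card_eq_zero.1 hn]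
  | succ n ih =>
    by_cases hex : ∃ u ∈ S, ∃ v ∈ S, G.Adj u v ∧ (G.nbrsIn S u ∩ G.nbrsIn S v).card ≤ 2 * c
    · obtain ⟨u, hu, v, hv, huv, hcom⟩ := hex
      have huA : u ∉ A := fun h => (hAS u h u hu).ne rfl
      have := ih (G.contractInto u v) (hG.contractInto huv) (S.erase u) (fun x hx y hy hxy =>
          ⟨fun e => huA (e ▸ hx), fun e => huA (e ▸ hy), Or.inl (hc x hx y hy hxy)⟩)
        (fun x hx y hy => ⟨fun e => huA (e ▸ hx), (Finset.mem_erase.1 hy).1,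
          Or.inl (hAS x hx y (Finset.mem_erase.1 hy).2)⟩)
        (by rw [Finset.card_erase_of_mem hu, hn]; rfl)
      have := G.card_dartsIn_contractInto hu hv huv
      linarith
    · push Not at hex
      by_contra hlt
      push Not at hlt
      obtain ⟨⟨v, w⟩, hvw⟩ := Finset.card_pos.1 (lt_of_le_of_lt (Nat.zero_le _) hlt)
      obtain ⟨hv, hw, hvw⟩ := SimpleGraph.mem_dartsIn.1 hvw
      simp only at hv hw hvw
      have hvA : v ∉ A := fun h => (hAS v h v hv).ne rfl
      set N := G.nbrsIn S v with hN
      have hwN : w ∈ N := SimpleGraph.mem_nbrsIn.2 ⟨hw, hvw⟩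
      have up := h G hG (insert v A) N (by rw [Finset.card_insert_of_notMem hvA, hA])
        (by
          intro x hx y hy hxy
          rw [Finset.mem_insert] at hx hy
          rcases hx with rfl | hx <;> rcases hy with rfl | hy
          · exact absurd rfl hxy
          · exact (hAS _ hy _ hv).symm
          · exact hAS _ hx _ hv
          · exact hc _ hx _ hy hxy)
        (by
          intro x hx y hy
          rcases Finset.mem_insert.1 hx with rfl | hx
          · exact (SimpleGraph.mem_nbrsIn.1 hy).2
          · exact hAS _ hx _ (SimpleGraph.mem_nbrsIn.1 hy).1)
      have low : (2 * c + 1) * N.card ≤ (G.dartsIn N).card := by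
        rw [SimpleGraph.card_dartsIn, mul_comm, ← smul_eq_mul]
        refine Finset.card_nsmul_le_sum _ _ _ fun x hx => ?_
        obtain ⟨hxS, hvx⟩ := SimpleGraph.mem_nbrsIn.1 hx
        refine (hex v hv x hxS hvx).trans_le (Finset.card_le_card ?_) |>.nat_succ_le
        intro y hy
        rw [Finset.mem_inter] at hy
        exact SimpleGraph.mem_nbrsIn.2 ⟨hy.1, (SimpleGraph.mem_nbrsIn.1 hy.2).2⟩
      have : 0 < N.card := Finset.card_pos.2 ⟨w, hwN⟩
      nlinarith

theorem coneSparse_one : ConeSparse V 1 7 := coneSparse_four_zero.step.step.step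

theorem IsDrawable.card_dartsIn_le {G : SimpleGraph V} (hG : IsDrawable G) (S : Finset V) :
    (G.dartsIn S).card ≤ 30 * S.card :=
  (coneSparse_one (V := V)).step G hG ∅ S rfl (by simp) (by simp)

/-- The neighbourhood of each vertex is sparse, so that there are few triangles. -/
theorem IsDrawable.card_triangles_le {G : SimpleGraph V} (hG : IsDrawable G)
    (B : Finset V) (R : Finset (V × V × V))
    (hR : ∀ x ∈ R, x.1 ∈ B ∧ x.2.1 ∈ B ∧ x.2.2 ∈ B ∧ G.Adj x.1 x.2.1 ∧ G.Adj x.1 x.2.2 ∧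
      G.Adj x.2.1 x.2.2) : R.card ≤ 420 * B.card := by
  classical
  have h1 : R.card ≤ ∑ b ∈ B, (G.dartsIn (G.nbrsIn B b)).card := by
    rw [← Finset.card_sigma]
    refine Finset.card_le_card_of_injOn (fun x => ⟨x.1, x.2⟩) ?_ ?_
    · intro x hx
      have := hR x hx
      simp only [Finset.coe_sigma, Set.mem_sigma_iff, Finset.mem_coe, SimpleGraph.mem_dartsIn,
        SimpleGraph.mem_nbrsIn]
      tauto
    · rintro ⟨a, b⟩ _ ⟨c, d⟩ _ h
      simpa using h
  have h2 : ∑ b ∈ B, (G.dartsIn (G.nbrsIn B b)).card ≤ ∑ b ∈ B, 14 * (G.nbrsIn B b).card := by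
    refine Finset.sum_le_sum fun b _ => ?_
    exact coneSparse_one G hG {b} _ (by simp) (by simp) (by
      intro x hx y hy
      rw [Finset.mem_singleton.1 hx]
      exact (SimpleGraph.mem_nbrsIn.1 hy).2)
  rw [← Finset.mul_sum, ← SimpleGraph.card_dartsIn] at h2
  have := hG.card_dartsIn_le B
  omega

/-- If the neighbourhoods of the vertices of `T` are cliques, then these vertices lie above
triangles of `B`, at most two of them above the same triangle, since `K₃,₃` is not drawable.
Otherwise some vertex of `T` can be contracted so that a new edge in `B` appears. -/
theorem IsDrawable.card_le_of_three_nbrs {G : SimpleGraph V} (hG : IsDrawable G) {B T : Finset V}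
    (hBT : Disjoint T B) (hT : ∀ t ∈ T, 3 ≤ (G.nbrsIn B t).card) : T.card ≤ 870 * B.card := by
  classical
  suffices h : 2 * T.card + (G.dartsIn B).card ≤ 1710 * B.card by omega
  induction hn : T.card generalizing G T with
  | zero => have := hG.card_dartsIn_le B; omega
  | succ n ih =>
    by_cases hex : ∃ t ∈ T, ∃ b ∈ G.nbrsIn B t, ∃ b' ∈ G.nbrsIn B t, b ≠ b' ∧ ¬ G.Adj b b'
    · obtain ⟨t, ht, b, hb, b', hb', hne, hnadj⟩ := hex
      obtain ⟨hbB, htb⟩ := SimpleGraph.mem_nbrsIn.1 hb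
      obtain ⟨hbB', htb'⟩ := SimpleGraph.mem_nbrsIn.1 hb'
      have htB : ∀ x ∈ B, x ≠ t := fun x hx e => Finset.disjoint_left.1 hBT ht (e ▸ hx)
      have hsub : ∀ x y, x ≠ t → y ≠ t → G.Adj x y → (G.contractInto t b).Adj x y :=
        fun x y hx hy h => ⟨hx, hy, Or.inl h⟩
      have h1 := ih (G := G.contractInto t b) (hG.contractInto htb) (T := T.erase t)
        (Finset.disjoint_of_subset_left (Finset.erase_subset _ _) hBT)
        (by
          intro s hs
          obtain ⟨hst, hs⟩ := Finset.mem_erase.1 hs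
          refine (hT s hs).trans (Finset.card_le_card ?_)
          intro x hx
          obtain ⟨hx, hsx⟩ := SimpleGraph.mem_nbrsIn.1 hx
          exact SimpleGraph.mem_nbrsIn.2 ⟨hx, hsub _ _ hst (htB x hx) hsx⟩)
        (by rw [Finset.card_erase_of_mem ht, hn]; rfl)
      have h2 : (G.dartsIn B).card + 2 ≤ ((G.contractInto t b).dartsIn B).card := by
        have e1 : (b, b') ∉ insert (b', b) (G.dartsIn B) := by
          simp only [Finset.mem_insert, Prod.mk.injEq, SimpleGraph.mem_dartsIn]
          tauto
        have e2 : (b', b) ∉ G.dartsIn B := by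
          simp only [SimpleGraph.mem_dartsIn]
          exact fun h => hnadj h.2.2.symm
        have := Finset.card_le_card (s := insert (b, b') (insert (b', b) (G.dartsIn B)))
            (t := (G.contractInto t b).dartsIn B) (by
          intro x hx
          simp only [Finset.mem_insert] at hx
          rcases hx with rfl | rfl | hx
          · exact SimpleGraph.mem_dartsIn.2 ⟨hbB, hbB', htB _ hbB, htB _ hbB',
              Or.inr (Or.inl ⟨rfl, hne.symm, htb'⟩)⟩
          · exact SimpleGraph.mem_dartsIn.2 ⟨hbB', hbB, htB _ hbB', htB _ hbB,
              Or.inr (Or.inr ⟨rfl, hne.symm, htb'⟩)⟩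
          · obtain ⟨hx1, hx2, hx3⟩ := SimpleGraph.mem_dartsIn.1 hx
            exact SimpleGraph.mem_dartsIn.2 ⟨hx1, hx2, hsub _ _ (htB _ hx1) (htB _ hx2) hx3⟩)
        rw [Finset.card_insert_of_notMem e1, Finset.card_insert_of_notMem e2] at this
        omega
      omega
    · push Not at hex
      have htri : ∀ t ∈ T, ∃ x : V × V × V, x.1 ∈ G.nbrsIn B t ∧ x.2.1 ∈ G.nbrsIn B t ∧
          x.2.2 ∈ G.nbrsIn B t ∧ x.1 ≠ x.2.1 ∧ x.1 ≠ x.2.2 ∧ x.2.1 ≠ x.2.2 := by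
        intro t ht
        obtain ⟨a, ha, b, hb, c, hc, h1, h2, h3⟩ := Finset.two_lt_card.1 (hT t ht)
        exact ⟨(a, b, c), ha, hb, hc, h1, h2, h3⟩
      choose! f hf1 hf2 hf3 hf4 hf5 hf6 using htri
      have hmem : ∀ {t x}, x ∈ G.nbrsIn B t → x ∈ B ∧ G.Adj t x := SimpleGraph.mem_nbrsIn.1
      have h1 := hG.card_triangles_le B (T.image f) (by
        intro x hx
        obtain ⟨t, ht, rfl⟩ := Finset.mem_image.1 hx
        exact ⟨(hmem (hf1 t ht)).1, (hmem (hf2 t ht)).1, (hmem (hf3 t ht)).1,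
          hex t ht _ (hf1 t ht) _ (hf2 t ht) (hf4 t ht),
          hex t ht _ (hf1 t ht) _ (hf3 t ht) (hf5 t ht),
          hex t ht _ (hf2 t ht) _ (hf3 t ht) (hf6 t ht)⟩)
      have h2 : T.card ≤ 2 * (T.image f).card := by
        refine Finset.card_le_mul_card_image T 2 fun x hx => ?_
        by_contra hlt
        push Not at hlt
        obtain ⟨a, ha, b, hb, c, hc, hab, hac, hbc⟩ := Finset.two_lt_card.1 hlt
        obtain ⟨ha, hax⟩ := Finset.mem_filter.1 ha
        obtain ⟨hb, hbx⟩ := Finset.mem_filter.1 hb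
        obtain ⟨hc, hcx⟩ := Finset.mem_filter.1 hc
        have hadj : ∀ t ∈ T, f t = x → G.Adj t x.1 ∧ G.Adj t x.2.1 ∧ G.Adj t x.2.2 := by
          rintro t ht rfl
          exact ⟨(hmem (hf1 t ht)).2, (hmem (hf2 t ht)).2, (hmem (hf3 t ht)).2⟩
        have hinj : ∀ p q r : V, p ≠ q → p ≠ r → q ≠ r → Function.Injective ![p, q, r] := by
          intro p q r h1 h2 h3 i j h
          fin_cases i <;> fin_cases j <;> simp_all
        refine hG.not_K33 (hinj a b c hab hac hbc) (hinj x.1 x.2.1 x.2.2 (hax ▸ hf4 a ha)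
          (hax ▸ hf5 a ha) (hax ▸ hf6 a ha)) ?_
        intro i j
        have := hadj a ha hax
        have := hadj b hb hbx
        have := hadj c hc hcx
        fin_cases i <;> fin_cases j <;> simp_all
      have := hG.card_dartsIn_le B
      omega

end

/-! ### Lagrange polynomials -/

section

section Lagrangian

variable {E : Type*}

/-- The Lagrange polynomial of a family `𝓗` of finite sets. -/
noncomputable def lagrangePoly (𝓗 : Finset (Finset E)) (w : E → ℝ) : ℝ :=
  ∑ H ∈ 𝓗, ∏ e ∈ H, w e

/-- The partial derivative of the Lagrange polynomial in the direction of `e`. -/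
noncomputable def lagrangeLink [DecidableEq E] (𝓗 : Finset (Finset E)) (w : E → ℝ) (e : E) : ℝ :=
  ∑ H ∈ 𝓗 with e ∈ H, ∏ f ∈ H.erase e, w f

theorem lagrangePoly_nonneg (𝓗 : Finset (Finset E)) {w : E → ℝ} (hw : ∀ e, 0 ≤ w e) :
    0 ≤ lagrangePoly 𝓗 w :=
  Finset.sum_nonneg fun _ _ => Finset.prod_nonneg fun _ _ => hw _

theorem lagrangePoly_smul {𝓗 : Finset (Finset E)} {m : ℕ} (hm : ∀ H ∈ 𝓗, H.card = m) (r : ℝ)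
    (w : E → ℝ) : lagrangePoly 𝓗 (fun e => r * w e) = r ^ m * lagrangePoly 𝓗 w := by
  rw [lagrangePoly, lagrangePoly, Finset.mul_sum]
  refine Finset.sum_congr rfl fun H hH => ?_
  rw [Finset.prod_mul_distrib, Finset.prod_const, hm H hH]

theorem lagrangePoly_sub [DecidableEq E] (𝓗 : Finset (Finset E)) (w : E → ℝ) (e : E) (δ : ℝ) :
    lagrangePoly 𝓗 (fun f => w f - if f = e then δ else 0)
      = lagrangePoly 𝓗 w - δ * lagrangeLink 𝓗 w e := by
  rw [lagrangePoly, lagrangePoly, lagrangeLink, Finset.sum_filter, Finset.mul_sum,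
    ← Finset.sum_sub_distrib]
  refine Finset.sum_congr rfl fun H _ => ?_
  by_cases he : e ∈ H
  · rw [if_pos he, ← Finset.mul_prod_erase H _ he, ← Finset.mul_prod_erase H w he, if_pos rfl,
      Finset.prod_congr rfl (g := w) (fun f hf => by rw [if_neg (Finset.ne_of_mem_erase hf), sub_zero])]
    ring
  · rw [if_neg he, Finset.prod_congr rfl (g := w)
      (fun f hf => by
        rw [if_neg (fun h : f = e => he (h ▸ hf)), sub_zero])]
    ring

/-- A bound for the partial derivative in the direction of a coordinate of maximal weight gives a
bound for the Lagrange polynomial: at a maximum point on the simplex, lowering a positive coordinate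
and rescaling does not increase the value, so that the partial derivative there is at least `m`
times the maximum. -/
theorem lagrangePoly_le [DecidableEq E] [Fintype E] {𝓗 : Finset (Finset E)} {m : ℕ} (hm0 : m ≠ 0)
    (hm : ∀ H ∈ 𝓗, H.card = m) {c : ℝ}
    (hlink : ∀ w : E → ℝ, (∀ e, 0 ≤ w e) → ∑ e, w e = 1 → ∀ e, (∀ f, w f ≤ w e) →
      lagrangeLink 𝓗 w e ≤ m * c) {w : E → ℝ} (hw : ∀ e, 0 ≤ w e) :
    lagrangePoly 𝓗 w ≤ c * (∑ e, w e) ^ m := by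
  have hs0 : 0 ≤ ∑ e, w e := Finset.sum_nonneg fun e _ => hw e
  rcases hs0.eq_or_lt with hs | hs
  · have h0 : ∀ e, w e = 0 := fun e =>
      (Finset.sum_eq_zero_iff_of_nonneg fun e _ => hw e).1 hs.symm e (Finset.mem_univ e)
    rw [← hs, zero_pow hm0, mul_zero, lagrangePoly]
    refine (Finset.sum_eq_zero fun H hH => ?_).le
    obtain ⟨e, he⟩ := Finset.card_pos.1 (by rw [hm H hH]; omega)
    exact Finset.prod_eq_zero he (h0 e)
  have hscale : ∀ w : E → ℝ, (∀ e, 0 ≤ w e) → 0 < ∑ e, w e →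
      (fun e => (∑ e, w e)⁻¹ * w e) ∈ stdSimplex ℝ E := fun w hw hs =>
    ⟨fun e => mul_nonneg (inv_nonneg.2 hs.le) (hw e), by
      rw [← Finset.mul_sum, inv_mul_cancel₀ hs.ne']⟩
  have hcont : ContinuousOn (lagrangePoly 𝓗) (stdSimplex ℝ E) := by
    unfold lagrangePoly
    fun_prop
  obtain ⟨v, hv, hmax⟩ := (isCompact_stdSimplex ℝ E).exists_isMaxOn ⟨_, hscale w hw hs⟩ hcont
  set β := lagrangePoly 𝓗 v
  have hβ0 : 0 ≤ β := lagrangePoly_nonneg 𝓗 hv.1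
  have hβ : ∀ u : E → ℝ, (∀ e, 0 ≤ u e) → 0 < ∑ e, u e →
      lagrangePoly 𝓗 u ≤ β * (∑ e, u e) ^ m := by
    intro u hu hus
    have h1 : lagrangePoly 𝓗 (fun e => (∑ e, u e)⁻¹ * u e) ≤ β := hmax (hscale u hu hus)
    rw [lagrangePoly_smul hm, inv_pow, inv_mul_le_iff₀ (pow_pos hus m)] at h1
    linarith
  have hne : (Finset.univ : Finset E).Nonempty := by
    rw [Finset.univ_nonempty_iff]
    by_contra h
    rw [not_nonempty_iff] at h
    simp at hs
  obtain ⟨e, -, he⟩ := Finset.exists_max_image Finset.univ v hne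
  have hve : 0 < v e := by
    by_contra h
    have : ∑ f, v f ≤ 0 := Finset.sum_nonpos fun f hf => (he f hf).trans (not_lt.1 h)
    rw [hv.2] at this
    linarith
  have hL : m * β ≤ lagrangeLink 𝓗 v e := by
    have key : ∀ δ : ℝ, 0 < δ → δ < 1 → δ < v e →
        m * β * (1 - δ) ^ m ≤ lagrangeLink 𝓗 v e := by
      intro δ h0 h1 h2
      have hsum : ∑ f, (v f - if f = e then δ else 0) = 1 - δ := by
        rw [Finset.sum_sub_distrib, hv.2]; simp
      have h3 := hβ (fun f => v f - if f = e then δ else 0) (fun f => by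
        by_cases hf : f = e
        · simp only [hf, if_true]; linarith
        · simp only [hf, if_false, sub_zero]; exact hv.1 f) (by rw [hsum]; linarith)
      rw [hsum, lagrangePoly_sub] at h3
      have b1 : 1 + m * δ ≤ (1 + δ) ^ m := one_add_mul_le_pow (by linarith) m
      have b2 : (1 - δ) ^ m * (1 + δ) ^ m ≤ 1 := by
        rw [← mul_pow]
        exact pow_le_one₀ (by nlinarith) (by nlinarith)
      have b3 : 0 ≤ (1 - δ) ^ m := pow_nonneg (by linarith) m
      have b4 : (1 - δ) ^ m * (1 + m * δ) ≤ 1 := (mul_le_mul_of_nonneg_left b1 b3).trans b2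
      have b5 : β * ((1 - δ) ^ m * (1 + m * δ)) ≤ β * 1 := mul_le_mul_of_nonneg_left b4 hβ0
      refine le_of_mul_le_mul_left ?_ h0
      change β - δ * lagrangeLink 𝓗 v e ≤ _ at h3
      linarith
    have hlim : Filter.Tendsto (fun δ : ℝ => m * β * (1 - δ) ^ m) (nhdsWithin 0 (Set.Ioi 0))
        (nhds (m * β * (1 - 0) ^ m)) :=
      (Continuous.tendsto (by fun_prop) 0).mono_left nhdsWithin_le_nhds
    rw [sub_zero, one_pow, mul_one] at hlim
    refine le_of_tendsto hlim ?_
    filter_upwards [Ioo_mem_nhdsGT (lt_min one_pos hve)] with δ hδ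
    exact key δ hδ.1 (hδ.2.trans_le (min_le_left _ _)) (hδ.2.trans_le (min_le_right _ _))
  have h1 := hlink v hv.1 hv.2 e (fun f => he f (Finset.mem_univ f))
  have h2 : β ≤ c := le_of_mul_le_mul_left (hL.trans h1) (by positivity)
  exact (hβ w hw hs).trans (mul_le_mul_of_nonneg_right h2 (by positivity))

end Lagrangian

/-- The estimate behind the bound for three-edge cycles: `a` and `b` are the weights of the edges
from the two ends of an edge of maximal weight `M`. -/
theorem sum_mul_le_one_ninth {ι : Type*} (Z : Finset ι) (a b : ι → ℝ) {M : ℝ}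
    (ha : ∀ z ∈ Z, 0 ≤ a z) (hb : ∀ z ∈ Z, 0 ≤ b z) (haM : ∀ z ∈ Z, a z ≤ M)
    (hbM : ∀ z ∈ Z, b z ≤ M) (hsum : M + ∑ z ∈ Z, a z + ∑ z ∈ Z, b z ≤ 1) :
    ∑ z ∈ Z, a z * b z ≤ 1 / 9 := by
  set A := ∑ z ∈ Z, a z
  set B := ∑ z ∈ Z, b z
  have hA : 0 ≤ A := Finset.sum_nonneg ha
  have hB : 0 ≤ B := Finset.sum_nonneg hb
  have h1 : ∑ z ∈ Z, a z * b z ≤ A * B := by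
    rw [Finset.sum_mul]
    exact Finset.sum_le_sum fun z hz =>
      mul_le_mul_of_nonneg_left (Finset.single_le_sum hb hz) (ha z hz)
  have h2 : ∑ z ∈ Z, a z * b z ≤ A * M := by
    rw [Finset.sum_mul]
    exact Finset.sum_le_sum fun z hz => mul_le_mul_of_nonneg_left (hbM z hz) (ha z hz)
  have h3 : ∑ z ∈ Z, a z * b z ≤ M * B := by
    rw [Finset.mul_sum]
    exact Finset.sum_le_sum fun z hz => mul_le_mul_of_nonneg_right (haM z hz) (hb z hz)
  rcases le_total M (1 / 3) with hM | hM
  · rcases Z.eq_empty_or_nonempty with rfl | ⟨z, hz⟩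
    · simp
    · have hM0 : 0 ≤ M := (ha z hz).trans (haM z hz)
      have : M * (A + B) ≤ M * (1 - M) := mul_le_mul_of_nonneg_left (by linarith) hM0
      nlinarith
  · nlinarith [sq_nonneg (A - B), mul_nonneg hA hB]

/-- The estimate behind the bound for four-edge cycles. Around an edge `x y` of maximal weight `M`
the numbers `A` and `B` are the total weights of the other edges at `x` and at `y`, the index `q`
runs over the edges avoiding `x` and `y`, of weight `c q`, and `s q` is the weight of the two ways to
join the ends of `q` to `x` and `y`. -/
theorem sum_mul_le_one_sixtyfourth {ι : Type*} (Q : Finset ι) (c s : ι → ℝ) {M A B : ℝ}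
    (hA : 0 ≤ A) (hB : 0 ≤ B) (hM : 0 ≤ M)
    (hc : ∀ q ∈ Q, 0 ≤ c q) (hcM : ∀ q ∈ Q, c q ≤ M) (hs : ∀ q ∈ Q, 0 ≤ s q)
    (hsum : M + A + B + ∑ q ∈ Q, c q ≤ 1) (hsAB : ∀ q ∈ Q, s q ≤ A * B)
    (hsM : ∀ q ∈ Q, s q ≤ M * (A + B) / 2)
    (hss : ∀ q ∈ Q, ∀ q' ∈ Q, q ≠ q' → s q + s q' ≤ 2 * M * (A + B) / 3) :
    ∑ q ∈ Q, c q * s q ≤ 1 / 64 := by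
  classical
  set R := ∑ q ∈ Q, c q with hR
  have hR0 : 0 ≤ R := Finset.sum_nonneg hc
  set X := A + B with hX
  have hX0 : 0 ≤ X := add_nonneg hA hB
  have bound : ∀ σ : ℝ, (∀ q ∈ Q, s q ≤ σ) → ∑ q ∈ Q, c q * s q ≤ R * σ := by
    intro σ h
    rw [hR, Finset.sum_mul]
    exact Finset.sum_le_sum fun q hq => mul_le_mul_of_nonneg_left (h q hq) (hc q hq)
  rcases le_total (1 / 4) M with hM4 | hM4
  · refine (bound _ hsAB).trans ?_
    have h1 : A * B ≤ X ^ 2 / 4 := by nlinarith [sq_nonneg (A - B)]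
    have h2 : R * (A * B) ≤ R * (X ^ 2 / 4) := mul_le_mul_of_nonneg_left h1 hR0
    have h3 : R ≤ 3 / 4 - X := by linarith
    have h4 : R * X ^ 2 ≤ (3 / 4 - X) * X ^ 2 := mul_le_mul_of_nonneg_right h3 (by positivity)
    nlinarith [mul_nonneg (by linarith : (0 : ℝ) ≤ X + 1 / 4) (sq_nonneg (X - 1 / 2))]
  rcases Q.eq_empty_or_nonempty with rfl | hne
  · simp
  obtain ⟨p, hp, hmax⟩ := Finset.exists_max_image Q s hne
  have hMX : 0 ≤ M * X := mul_nonneg hM hX0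
  have hXle : X ≤ 1 - M - R := by linarith
  rcases le_total R M with hRM | hRM
  · refine (bound _ hsM).trans ?_
    have h1 : R * (M * X / 2) ≤ R * (M * (1 - M - R) / 2) := by gcongr
    have h2 : R * (1 - M - R) ≤ M * (1 - M - M) := by nlinarith
    have h3 : M * (R * (1 - M - R)) ≤ M * (M * (1 - M - M)) := mul_le_mul_of_nonneg_left h2 hM
    nlinarith [mul_nonneg (by linarith : (0 : ℝ) ≤ 1 / 4 - M) (sq_nonneg (M - 1 / 4)),
      mul_nonneg hM (by linarith : (0 : ℝ) ≤ 1 / 4 - M)]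
  -- the second largest value of `s`
  set σ := min (s p) (2 * M * X / 3 - s p) with hσ
  have hσ1 : σ ≤ s p := min_le_left _ _
  have hσ2 : s p + σ ≤ 2 * M * X / 3 := by
    have : σ ≤ 2 * M * X / 3 - s p := min_le_right _ _
    linarith
  have hsplit : ∑ q ∈ Q, c q * s q ≤ M * s p + (R - M) * σ := by
    have h1 : ∑ q ∈ Q.erase p, c q * s q ≤ (∑ q ∈ Q.erase p, c q) * σ := by
      rw [Finset.sum_mul]
      refine Finset.sum_le_sum fun q hq => ?_
      obtain ⟨hqp, hq⟩ := Finset.mem_erase.1 hq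
      refine mul_le_mul_of_nonneg_left (le_min (hmax q hq) ?_) (hc q hq)
      linarith [hss q hq p hp hqp]
    have h2 := Finset.add_sum_erase Q c hp
    have h3 := Finset.add_sum_erase Q (fun q => c q * s q) hp
    rw [← h3]
    have h4 : ∑ q ∈ Q.erase p, c q = R - c p := by linarith
    rw [h4] at h1
    nlinarith [mul_nonneg (sub_nonneg.2 (hcM p hp)) (sub_nonneg.2 hσ1)]
  refine hsplit.trans ?_
  have hsp := hsM p hp
  have hsp0 := hs p hp
  rcases le_total R (2 * M) with hR2 | hR2
  · have h1 : M * s p + (R - M) * σ ≤ M * X * (2 * M + R) / 6 := by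
      nlinarith [mul_le_mul_of_nonneg_left hsp (sub_nonneg.2 hR2),
        mul_le_mul_of_nonneg_left hσ2 (sub_nonneg.2 hRM)]
    have h2 : M * X * (2 * M + R) / 6 ≤ M * (1 - M - R) * (2 * M + R) / 6 := by gcongr
    have h3 : M * ((1 - M - R) * (2 * M + R)) ≤ 3 / 32 := by
      rcases le_total (1 / 5) M with hM5 | hM5
      · have h4 : (1 - M - R) * (2 * M + R) ≤ (1 - 2 * M) * (3 * M) := by nlinarith
        have h5 := mul_le_mul_of_nonneg_left h4 hM
        nlinarith [mul_nonneg (by linarith : (0 : ℝ) ≤ 1 / 4 - M) (sq_nonneg (M - 1 / 4)),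
          mul_nonneg hM (by linarith : (0 : ℝ) ≤ 1 / 4 - M)]
      · have h4 : (1 - M - R) * (2 * M + R) ≤ ((1 + M) / 2) ^ 2 := by
          nlinarith [sq_nonneg ((1 - M - R) - (2 * M + R))]
        have h5 : ((1 + M) / 2) ^ 2 ≤ ((1 + 1 / 5) / 2) ^ 2 := by gcongr
        have h6 := mul_le_mul_of_nonneg_left (h4.trans h5) hM
        nlinarith
    linarith
  · have hσ3 : σ ≤ M * X / 3 := by linarith
    have h1 : M * s p + (R - M) * σ ≤ M * (X * R) / 3 := by
      nlinarith [mul_le_mul_of_nonneg_left hσ3 (sub_nonneg.2 hR2),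
        mul_le_mul_of_nonneg_left hσ2 hM]
    have h4 : X * R ≤ (1 - M) ^ 2 / 4 := by nlinarith [sq_nonneg (X - R)]
    have h5 := mul_le_mul_of_nonneg_left h4 hM
    nlinarith [mul_nonneg hM (by linarith : (0 : ℝ) ≤ 1 / 4 - M)]

end

/-! ### Cycle systems; triangles -/

section

variable {V : Type*} [DecidableEq V]

theorem eq_or_swap_of_pair_eq_pair {a b c d : V} (h : ({a, b} : Finset V) = {c, d}) :
    (a = c ∧ b = d) ∨ (a = d ∧ b = c) := by
  have ha : a ∈ ({c, d} : Finset V) := h ▸ by simp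
  have hb : b ∈ ({c, d} : Finset V) := h ▸ by simp
  have hc : c ∈ ({a, b} : Finset V) := h.symm ▸ by simp
  have hd : d ∈ ({a, b} : Finset V) := h.symm ▸ by simp
  simp only [Finset.mem_insert, Finset.mem_singleton] at ha hb hc hd
  grind

theorem injective_cycle_edges {m : ℕ} [NeZero m] (hm : 3 ≤ m) {b : Fin m → V}
    (hb : Function.Injective b) : Function.Injective fun i => ({b i, b (i + 1)} : Finset V) := by
  intro i j hij
  rcases eq_or_swap_of_pair_eq_pair hij with ⟨h, -⟩ | ⟨h1, h2⟩
  · exact hb h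
  · have h1 := hb h1
    have h2 := hb h2
    rw [h1, add_assoc] at h2
    have h3 : (1 + 1 : Fin m) = 0 := by simpa using h2
    have h4 := congrArg Fin.val h3
    simp only [Fin.val_add, Fin.val_zero, Fin.val_one'] at h4
    rw [Nat.mod_eq_of_lt (by omega : 1 < m), Nat.mod_eq_of_lt (by omega)] at h4
    omega

variable [Fintype V]

/-- The edge sets of the cycles of length `m` on the vertex set `V`; an edge is a set of two
vertices. -/
def cycleSystem (V : Type*) [Fintype V] [DecidableEq V] (m : ℕ) [NeZero m] :
    Finset (Finset (Finset V)) :=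
  ((Finset.univ : Finset (Fin m → V)).filter fun b => Function.Injective b).image
    fun b => Finset.univ.image fun i => {b i, b (i + 1)}

theorem mem_cycleSystem {m : ℕ} [NeZero m] {H : Finset (Finset V)} :
    H ∈ cycleSystem V m ↔ ∃ b : Fin m → V, Function.Injective b ∧
      Finset.univ.image (fun i => ({b i, b (i + 1)} : Finset V)) = H := by
  simp [cycleSystem]

theorem card_of_mem_cycleSystem {m : ℕ} [NeZero m] (hm : 3 ≤ m) {H : Finset (Finset V)}
    (hH : H ∈ cycleSystem V m) : H.card = m := by
  obtain ⟨b, hb, rfl⟩ := mem_cycleSystem.1 hH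
  rw [Finset.card_image_of_injective _ (injective_cycle_edges hm hb), Finset.card_univ,
    Fintype.card_fin]

/-- The weights of the edges `x y`, of the other edges at `x`, of the other edges at `y`, and of the
edges avoiding `x` and `y` add up to at most the total weight. -/
theorem sum_weights_around_edge_le {w : Finset V → ℝ} (hw : ∀ e, 0 ≤ w e) {x y : V} (hxy : x ≠ y)
    (Q : Finset (Finset V)) (hQ : ∀ q ∈ Q, x ∉ q ∧ y ∉ q) :
    w {x, y} + ∑ z ∈ {x, y}ᶜ, w {x, z} + ∑ z ∈ {x, y}ᶜ, w {y, z} + ∑ q ∈ Q, w q ≤ ∑ e, w e := by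
  set Z : Finset V := {x, y}ᶜ
  have hZ : ∀ z ∈ Z, z ≠ x ∧ z ≠ y := by
    intro z hz
    simpa [Z, not_or] using hz
  have himg : ∀ p q : V, p ∉ Z → q ∉ Z → ∑ z ∈ Z, w {p, z} = ∑ e ∈ Z.image (fun z => {p, z}), w e := by
    intro p q hp hq
    rw [Finset.sum_image]
    intro z hz z' hz' h
    rcases eq_or_swap_of_pair_eq_pair h with ⟨-, h⟩ | ⟨h, -⟩
    · exact h
    · exact absurd (h ▸ hz') hp
  have hxZ : x ∉ Z := by simp [Z]
  have hyZ : y ∉ Z := by simp [Z]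
  rw [himg x y hxZ hyZ, himg y x hyZ hxZ, ← Finset.sum_singleton w {x, y},
    ← Finset.sum_union, ← Finset.sum_union, ← Finset.sum_union]
  · exact Finset.sum_le_univ_sum_of_nonneg hw
  · rw [Finset.disjoint_left]
    intro e he heQ
    obtain ⟨h1, h2⟩ := hQ e heQ
    simp only [Finset.mem_union, Finset.mem_singleton, Finset.mem_image] at he
    rcases he with (rfl | ⟨z, -, rfl⟩) | ⟨z, -, rfl⟩ <;> simp at h1 h2
  · rw [Finset.disjoint_left]
    intro e he he'
    simp only [Finset.mem_union, Finset.mem_singleton, Finset.mem_image] at he he'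
    obtain ⟨z', hz', rfl⟩ := he'
    obtain ⟨h1, h2⟩ := hZ z' hz'
    rcases he with he | ⟨z, hz, he⟩
    · rcases eq_or_swap_of_pair_eq_pair he with ⟨h, -⟩ | ⟨-, h⟩
      · exact hxy h.symm
      · exact h1 h
    · obtain ⟨h3, h4⟩ := hZ z hz
      rcases eq_or_swap_of_pair_eq_pair he with ⟨h, -⟩ | ⟨h, -⟩
      · exact hxy h
      · exact h1 h.symm
  · rw [Finset.disjoint_left]
    intro e he he'
    simp only [Finset.mem_singleton, Finset.mem_image] at he he'
    obtain ⟨z', hz', rfl⟩ := he'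
    obtain ⟨h1, h2⟩ := hZ z' hz'
    rcases eq_or_swap_of_pair_eq_pair he with ⟨-, h⟩ | ⟨-, h⟩
    · exact h2 h
    · exact h1 h

/-- Every cycle through `e` can be traversed starting with `e`. The direction is not prescribed. -/
theorem exists_rotation_of_mem_cycleSystem {m : ℕ} [NeZero m] {H : Finset (Finset V)}
    (hH : H ∈ cycleSystem V m) {e : Finset V} (he : e ∈ H) :
    ∃ b : Fin m → V, Function.Injective b ∧ e = {b 0, b 1} ∧
      Finset.univ.image (fun i => ({b i, b (i + 1)} : Finset V)) = H := by
  obtain ⟨b, hb, rfl⟩ := mem_cycleSystem.1 hH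
  obtain ⟨i, -, rfl⟩ := Finset.mem_image.1 he
  refine ⟨fun j => b (j + i), hb.comp (add_left_injective i), by simp [add_comm], ?_⟩
  ext f
  simp only [Finset.mem_image, Finset.mem_univ, true_and]
  constructor
  · rintro ⟨j, rfl⟩
    exact ⟨j + i, by rw [add_right_comm]⟩
  · rintro ⟨j, rfl⟩
    exact ⟨j - i, by rw [add_right_comm, sub_add_cancel]⟩

theorem lagrangeLink_le_sum {E ι : Type*} [DecidableEq E] {𝓗 : Finset (Finset E)} {w : E → ℝ}
    (hw : ∀ e, 0 ≤ w e) {e : E} (P : Finset ι) (F : ι → Finset E)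
    (hF : ∀ H ∈ 𝓗, e ∈ H → ∃ p ∈ P, F p = H) :
    lagrangeLink 𝓗 w e ≤ ∑ p ∈ P, ∏ f ∈ (F p).erase e, w f := by
  classical
  have h0 : ∀ H : Finset E, 0 ≤ ∏ f ∈ H.erase e, w f := fun H => Finset.prod_nonneg fun _ _ => hw _
  have hsub : (𝓗.filter fun H => e ∈ H) ⊆ P.image F := by
    intro H hH
    obtain ⟨h1, h2⟩ := Finset.mem_filter.1 hH
    obtain ⟨p, hp, rfl⟩ := hF H h1 h2
    exact Finset.mem_image_of_mem _ hp
  calc lagrangeLink 𝓗 w e ≤ ∑ H ∈ P.image F, ∏ f ∈ H.erase e, w f :=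
        Finset.sum_le_sum_of_subset_of_nonneg hsub fun _ _ _ => h0 _
    _ ≤ ∑ p ∈ P, ∏ f ∈ (F p).erase e, w f := by
        rw [← Finset.sum_fiberwise_of_maps_to (s := P) (t := P.image F) (g := F)
          (fun p hp => Finset.mem_image_of_mem _ hp)]
        refine Finset.sum_le_sum fun H hH => ?_
        obtain ⟨p, hp, rfl⟩ := Finset.mem_image.1 hH
        exact Finset.single_le_sum (f := fun p => ∏ f ∈ (F p).erase e, w f) (fun _ _ => h0 _)
          (Finset.mem_filter.2 ⟨hp, rfl⟩)

theorem lagrangeLink_eq_zero {E : Type*} [DecidableEq E] {𝓗 : Finset (Finset E)} (w : E → ℝ) {e : E}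
    (h : ∀ H ∈ 𝓗, e ∉ H) : lagrangeLink 𝓗 w e = 0 := by
  rw [lagrangeLink, Finset.filter_false_of_mem h, Finset.sum_empty]

theorem lagrangeLink_triangle_le {w : Finset V → ℝ} (hw : ∀ e, 0 ≤ w e) (hsum : ∑ e, w e = 1)
    {e : Finset V} (hmax : ∀ f, w f ≤ w e) : lagrangeLink (cycleSystem V 3) w e ≤ 1 / 9 := by
  by_cases hex : ∃ H ∈ cycleSystem V 3, e ∈ H
  swap
  · push Not at hex
    rw [lagrangeLink_eq_zero w hex]
    norm_num
  obtain ⟨H, hH, he⟩ := hex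
  obtain ⟨b, hb, rfl, -⟩ := exists_rotation_of_mem_cycleSystem hH he
  set x := b 0
  set y := b 1
  have hxy : x ≠ y := hb.ne (by decide)
  set Z : Finset V := {x, y}ᶜ
  have hZ : ∀ z ∈ Z, z ≠ x ∧ z ≠ y := fun z hz => by simpa [Z, not_or] using hz
  have h1 := lagrangeLink_le_sum (𝓗 := cycleSystem V 3) hw (e := {x, y}) Z
    (fun z => {{x, y}, {x, z}, {y, z}}) (by
      intro H hH he
      obtain ⟨b, hb, hxy, rfl⟩ := exists_rotation_of_mem_cycleSystem hH he
      have h20 : b 2 ≠ b 0 := hb.ne (by decide)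
      have h21 : b 2 ≠ b 1 := hb.ne (by decide)
      have hu : (Finset.univ : Finset (Fin 3)) = {0, 1, 2} := by decide
      have e1 : (1 + 1 : Fin 3) = 2 := rfl
      have e2 : (2 + 1 : Fin 3) = 0 := rfl
      rcases eq_or_swap_of_pair_eq_pair hxy with ⟨h, h'⟩ | ⟨h, h'⟩
      · refine ⟨b 2, by simp [Z, h, h', h20, h21], ?_⟩
        rw [hu, Finset.image_insert, Finset.image_insert, Finset.image_singleton, h, h', zero_add,
          e1, e2, Finset.pair_comm (b 2) (b 0)]
        ext f; simp only [Finset.mem_insert, Finset.mem_singleton]; tauto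
      · refine ⟨b 2, by simp [Z, h, h', h20, h21], ?_⟩
        rw [hu, Finset.image_insert, Finset.image_insert, Finset.image_singleton, h, h', zero_add,
          e1, e2, Finset.pair_comm (b 2) (b 0), Finset.pair_comm (b 1) (b 0)])
  refine h1.trans ?_
  have h2 : ∀ z ∈ Z, ∏ f ∈ ({{x, y}, {x, z}, {y, z}} : Finset (Finset V)).erase {x, y}, w f
      = w {x, z} * w {y, z} := by
    intro z hz
    obtain ⟨hzx, hzy⟩ := hZ z hz
    rw [Finset.erase_insert, Finset.prod_pair]
    · intro h
      rcases eq_or_swap_of_pair_eq_pair h with ⟨h, -⟩ | ⟨h, -⟩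
      · exact hxy h
      · exact hzx h.symm
    · simp only [Finset.mem_insert, Finset.mem_singleton, not_or]
      constructor
      · intro h
        rcases eq_or_swap_of_pair_eq_pair h with ⟨-, h⟩ | ⟨h, -⟩
        · exact hzy h.symm
        · exact hzx h.symm
      · intro h
        rcases eq_or_swap_of_pair_eq_pair h with ⟨h, -⟩ | ⟨h, -⟩
        · exact hxy h
        · exact hzx h.symm
  rw [Finset.sum_congr rfl h2]
  refine sum_mul_le_one_ninth Z (fun z => w {x, z}) (fun z => w {y, z}) (M := w {x, y})
    (fun _ _ => hw _) (fun _ _ => hw _) (fun _ _ => hmax _) (fun _ _ => hmax _) ?_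
  have := sum_weights_around_edge_le hw hxy ∅ (by simp)
  rw [Finset.sum_empty, add_zero, hsum] at this
  exact this

end

/-! ### Four-cycles -/

section

variable {V : Type*} [Fintype V] [DecidableEq V]

theorem sum_le_sum_of_subset' {ι : Type*} {Z : Finset ι} {a : ι → ℝ} (ha : ∀ z, 0 ≤ a z)
    {Y : Finset ι} (hY : Y ⊆ Z) : ∑ z ∈ Y, a z ≤ ∑ z ∈ Z, a z :=
  Finset.sum_le_sum_of_subset_of_nonneg hY fun _ _ _ => ha _

/-- Two different pairs `q` and `q'` cannot both carry the maximal value `M (A + B) / 2` of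
`a u * b v + a v * b u`. -/
theorem cross_add_cross_le {ι : Type*} [DecidableEq ι] {Z : Finset ι} {a b : ι → ℝ} {M : ℝ}
    (ha : ∀ z, 0 ≤ a z) (hb : ∀ z, 0 ≤ b z) (haM : ∀ z, a z ≤ M) (hbM : ∀ z, b z ≤ M)
    {u v u' v' : ι} (hu : u ∈ Z) (hv : v ∈ Z) (hu' : u' ∈ Z) (hv' : v' ∈ Z) (huv : u ≠ v)
    (huv' : u' ≠ v') (hne : ({u, v} : Finset ι) ≠ {u', v'}) :
    (a u * b v + a v * b u) + (a u' * b v' + a v' * b u')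
      ≤ 2 * M * (∑ z ∈ Z, a z + ∑ z ∈ Z, b z) / 3 := by
  have hM : 0 ≤ M := (ha u).trans (haM u)
  -- two pairs with a common element `p`
  have shared : ∀ p q r : ι, p ∈ Z → q ∈ Z → r ∈ Z → p ≠ q → p ≠ r → q ≠ r →
      (a p * b q + a q * b p) + (a p * b r + a r * b p)
        ≤ 2 * M * (∑ z ∈ Z, a z + ∑ z ∈ Z, b z) / 3 := by
    intro p q r hp hq hr hpq hpr hqr
    have hsub : ({p, q, r} : Finset ι) ⊆ Z := by
      intro z hz
      simp only [Finset.mem_insert, Finset.mem_singleton] at hz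
      rcases hz with rfl | rfl | rfl <;> assumption
    have hA := sum_le_sum_of_subset' ha hsub
    have hB := sum_le_sum_of_subset' hb hsub
    rw [Finset.sum_insert (by simp [hpq, hpr]), Finset.sum_pair hqr] at hA hB
    have key : ∀ s t : ℝ, 0 ≤ s → 0 ≤ t → s ≤ M → t ≤ 2 * M → 3 * (s * t) ≤ 2 * M * (s + t) := by
      intro s t h1 h2 h3 h4
      nlinarith [mul_nonneg h1 (sub_nonneg.2 h4), mul_nonneg h2 (sub_nonneg.2 h3)]
    have k1 := key (a p) (b q + b r) (ha p) (add_nonneg (hb q) (hb r)) (haM p)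
      (by linarith [hbM q, hbM r])
    have k2 := key (b p) (a q + a r) (hb p) (add_nonneg (ha q) (ha r)) (hbM p)
      (by linarith [haM q, haM r])
    have := mul_le_mul_of_nonneg_left (add_le_add hA hB) hM
    nlinarith
  by_cases h1 : u = u'
  · subst h1
    exact shared u v v' hu hv hv' huv huv' (fun h => hne (by rw [h]))
  by_cases h2 : u = v'
  · subst h2
    have := shared u v u' hu hv hu' huv h1 (fun h => hne (by rw [h, Finset.pair_comm]))
    linarith
  by_cases h3 : v = u'
  · subst h3
    have := shared v u v' hv hu hv' huv.symm huv' h2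
    linarith
  by_cases h4 : v = v'
  · subst h4
    have := shared v u u' hv hu hu' huv.symm h3 h1
    linarith
  have hsub : ({u, v, u', v'} : Finset ι) ⊆ Z := by
    intro z hz
    simp only [Finset.mem_insert, Finset.mem_singleton] at hz
    rcases hz with rfl | rfl | rfl | rfl <;> assumption
  have hA := sum_le_sum_of_subset' ha hsub
  have hB := sum_le_sum_of_subset' hb hsub
  rw [Finset.sum_insert (by simp [huv, h1, h2]), Finset.sum_insert (by simp [h3, h4]),
    Finset.sum_pair huv'] at hA hB
  have key : ∀ s t : ℝ, 0 ≤ s → 0 ≤ t → s ≤ M → t ≤ M → 2 * (s * t) ≤ M * (s + t) := by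
    intro s t h1 h2 h3 h4
    nlinarith [mul_nonneg h1 (sub_nonneg.2 h4), mul_nonneg h2 (sub_nonneg.2 h3)]
  have k1 := key _ _ (ha u) (hb v) (haM u) (hbM v)
  have k2 := key _ _ (ha v) (hb u) (haM v) (hbM u)
  have k3 := key _ _ (ha u') (hb v') (haM u') (hbM v')
  have k4 := key _ _ (ha v') (hb u') (haM v') (hbM u')
  have k5 := mul_le_mul_of_nonneg_left (add_le_add hA hB) hM
  have k6 : 0 ≤ M * (∑ z ∈ Z, a z + ∑ z ∈ Z, b z) :=
    mul_nonneg hM (add_nonneg (Finset.sum_nonneg fun _ _ => ha _)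
      (Finset.sum_nonneg fun _ _ => hb _))
  nlinarith

theorem lagrangeLink_fourCycle_le {w : Finset V → ℝ} (hw : ∀ e, 0 ≤ w e) (hsum : ∑ e, w e = 1)
    {e : Finset V} (hmax : ∀ f, w f ≤ w e) : lagrangeLink (cycleSystem V 4) w e ≤ 1 / 64 := by
  by_cases hex : ∃ H ∈ cycleSystem V 4, e ∈ H
  swap
  · push Not at hex
    rw [lagrangeLink_eq_zero w hex]
    norm_num
  obtain ⟨H, hH, he⟩ := hex
  obtain ⟨b, hb, rfl, -⟩ := exists_rotation_of_mem_cycleSystem hH he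
  set x := b 0
  set y := b 1
  have hxy : x ≠ y := hb.ne (by decide)
  set Z : Finset V := {x, y}ᶜ
  have hZ : ∀ z ∈ Z, z ≠ x ∧ z ≠ y := fun z hz => by simpa [Z, not_or] using hz
  have h1 := lagrangeLink_le_sum (𝓗 := cycleSystem V 4) hw (e := {x, y}) Z.offDiag
    (fun p => {{x, y}, {x, p.1}, {p.1, p.2}, {y, p.2}}) (by
      intro H hH he
      obtain ⟨b, hb, hxy, rfl⟩ := exists_rotation_of_mem_cycleSystem hH he
      have h20 : b 2 ≠ b 0 := hb.ne (by decide)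
      have h21 : b 2 ≠ b 1 := hb.ne (by decide)
      have h30 : b 3 ≠ b 0 := hb.ne (by decide)
      have h31 : b 3 ≠ b 1 := hb.ne (by decide)
      have h32 : b 3 ≠ b 2 := hb.ne (by decide)
      have hu : (Finset.univ : Finset (Fin 4)) = {0, 1, 2, 3} := by decide
      have e1 : (1 + 1 : Fin 4) = 2 := rfl
      have e2 : (2 + 1 : Fin 4) = 3 := rfl
      have e3 : (3 + 1 : Fin 4) = 0 := rfl
      rcases eq_or_swap_of_pair_eq_pair hxy with ⟨h, h'⟩ | ⟨h, h'⟩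
      · refine ⟨(b 3, b 2), by simp [Z, h, h', h20, h21, h30, h31, h32], ?_⟩
        rw [hu, Finset.image_insert, Finset.image_insert, Finset.image_insert,
          Finset.image_singleton, h, h', zero_add, e1, e2, e3, Finset.pair_comm (b 3) (b 0),
          Finset.pair_comm (b 3) (b 2)]
        ext f; simp only [Finset.mem_insert, Finset.mem_singleton]; tauto
      · refine ⟨(b 2, b 3), by simp [Z, h, h', h20, h21, h30, h31, h32.symm], ?_⟩
        rw [hu, Finset.image_insert, Finset.image_insert, Finset.image_insert,
          Finset.image_singleton, h, h', zero_add, e1, e2, e3, Finset.pair_comm (b 3) (b 0),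
          Finset.pair_comm (b 1) (b 0)])
  refine h1.trans ?_
  set a : V → ℝ := fun z => w {x, z}
  set c : V → ℝ := fun z => w {y, z}
  have h2 : ∀ p ∈ Z.offDiag,
      ∏ f ∈ ({{x, y}, {x, p.1}, {p.1, p.2}, {y, p.2}} : Finset (Finset V)).erase {x, y}, w f
      = w {p.1, p.2} * (a p.1 * c p.2) := by
    rintro ⟨u, v⟩ hp
    obtain ⟨hu, hv, huv⟩ := Finset.mem_offDiag.1 hp
    simp only at hu hv huv
    obtain ⟨hux, huy⟩ := hZ u hu
    obtain ⟨hvx, hvy⟩ := hZ v hv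
    have hne : ∀ p q r s : V, (p ≠ r ∨ q ≠ s) → (p ≠ s ∨ q ≠ r) →
        ({p, q} : Finset V) ≠ {r, s} := by
      intro p q r s h h' he
      rcases eq_or_swap_of_pair_eq_pair he with he | he <;> tauto
    rw [Finset.erase_insert, Finset.prod_insert, Finset.prod_pair]
    · simp only [a, c]; ring
    · exact hne _ _ _ _ (Or.inl huy) (Or.inl huv)
    · simp only [Finset.mem_insert, Finset.mem_singleton, not_or]
      exact ⟨hne _ _ _ _ (Or.inl hux.symm) (Or.inl hvx.symm),
        hne _ _ _ _ (Or.inl hxy) (Or.inl hvx.symm)⟩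
    · simp only [Finset.mem_insert, Finset.mem_singleton, not_or]
      exact ⟨hne _ _ _ _ (Or.inr huy.symm) (Or.inl hux.symm),
        hne _ _ _ _ (Or.inl hux.symm) (Or.inl hvx.symm),
        hne _ _ _ _ (Or.inl hxy) (Or.inl hvx.symm)⟩
  rw [Finset.sum_congr rfl h2]
  -- collect the two ordered pairs that give the same edge
  set Q : Finset (Finset V) := Z.offDiag.image fun p => {p.1, p.2} with hQ
  set s : Finset V → ℝ := fun q => ∑ p ∈ Z.offDiag with ({p.1, p.2} : Finset V) = q, a p.1 * c p.2
  have h3 : ∑ p ∈ Z.offDiag, w {p.1, p.2} * (a p.1 * c p.2) = ∑ q ∈ Q, w q * s q := by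
    rw [← Finset.sum_fiberwise_of_maps_to (s := Z.offDiag) (t := Q)
      (g := fun p => ({p.1, p.2} : Finset V)) (fun p hp => Finset.mem_image_of_mem _ hp)]
    refine Finset.sum_congr rfl fun q _ => ?_
    simp only [s]
    rw [Finset.mul_sum]
    refine Finset.sum_congr rfl fun p hp => ?_
    rw [(Finset.mem_filter.1 hp).2]
  rw [h3]
  have hs : ∀ u v, u ∈ Z → v ∈ Z → u ≠ v → s {u, v} = a u * c v + a v * c u := by
    intro u v hu hv huv
    have : (Z.offDiag.filter fun p => ({p.1, p.2} : Finset V) = {u, v}) = {(u, v), (v, u)} := by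
      ext ⟨p, q⟩
      simp only [Finset.mem_filter, Finset.mem_offDiag, Finset.mem_insert, Finset.mem_singleton,
        Prod.mk.injEq]
      constructor
      · rintro ⟨-, h⟩
        exact eq_or_swap_of_pair_eq_pair h
      · rintro (⟨rfl, rfl⟩ | ⟨rfl, rfl⟩)
        · exact ⟨⟨hu, hv, huv⟩, rfl⟩
        · exact ⟨⟨hv, hu, huv.symm⟩, Finset.pair_comm _ _⟩
    simp only [s]
    rw [this, Finset.sum_pair (by simp [huv])]
  have ha : ∀ z, 0 ≤ a z := fun _ => hw _
  have hc : ∀ z, 0 ≤ c z := fun _ => hw _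
  have hQm : ∀ q ∈ Q, ∃ u v, u ∈ Z ∧ v ∈ Z ∧ u ≠ v ∧ q = {u, v} := by
    intro q hq
    obtain ⟨⟨u, v⟩, hp, rfl⟩ := Finset.mem_image.1 hq
    obtain ⟨hu, hv, huv⟩ := Finset.mem_offDiag.1 hp
    exact ⟨u, v, hu, hv, huv, rfl⟩
  have hsum2 : ∀ (d : V → ℝ), (∀ z, 0 ≤ d z) → ∀ u v, u ∈ Z → v ∈ Z → u ≠ v →
      d u + d v ≤ ∑ z ∈ Z, d z := by
    intro d hd u v hu hv huv
    rw [← Finset.sum_pair huv]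
    exact sum_le_sum_of_subset' hd (by
      intro z hz
      simp only [Finset.mem_insert, Finset.mem_singleton] at hz
      rcases hz with rfl | rfl <;> assumption)
  refine sum_mul_le_one_sixtyfourth Q w s (M := w {x, y}) (A := ∑ z ∈ Z, a z) (B := ∑ z ∈ Z, c z)
    (Finset.sum_nonneg fun _ _ => ha _) (Finset.sum_nonneg fun _ _ => hc _) (hw _)
    (fun _ _ => hw _) (fun _ _ => hmax _)
    (fun _ _ => Finset.sum_nonneg fun _ _ => mul_nonneg (ha _) (hc _)) ?_ ?_ ?_ ?_
  · rw [← hsum]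
    refine sum_weights_around_edge_le hw hxy Q ?_
    intro q hq
    obtain ⟨u, v, hu, hv, -, rfl⟩ := hQm q hq
    have := hZ u hu
    have := hZ v hv
    simp only [Finset.mem_insert, Finset.mem_singleton, not_or]
    tauto
  · intro q hq
    obtain ⟨u, v, hu, hv, huv, rfl⟩ := hQm q hq
    rw [hs u v hu hv huv]
    have h4 := mul_le_mul (hsum2 a ha u v hu hv huv) (hsum2 c hc u v hu hv huv)
      (add_nonneg (hc _) (hc _)) (Finset.sum_nonneg fun _ _ => ha _)
    nlinarith [mul_nonneg (ha u) (hc u), mul_nonneg (ha v) (hc v)]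
  · intro q hq
    obtain ⟨u, v, hu, hv, huv, rfl⟩ := hQm q hq
    rw [hs u v hu hv huv]
    have key : ∀ z z', 2 * (a z * c z') ≤ w {x, y} * (a z + c z') := by
      intro z z'
      have h1 : a z ≤ w {x, y} := hmax _
      have h2 : c z' ≤ w {x, y} := hmax _
      nlinarith [mul_nonneg (ha z) (sub_nonneg.2 h2), mul_nonneg (hc z') (sub_nonneg.2 h1)]
    have := key u v
    have := key v u
    have := mul_le_mul_of_nonneg_left (add_le_add (hsum2 a ha u v hu hv huv)
      (hsum2 c hc u v hu hv huv)) (hw {x, y})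
    nlinarith
  · intro q hq q' hq' hne
    obtain ⟨u, v, hu, hv, huv, rfl⟩ := hQm q hq
    obtain ⟨u', v', hu', hv', huv', rfl⟩ := hQm q' hq'
    rw [hs u v hu hv huv, hs u' v' hu' hv' huv']
    exact cross_add_cross_le ha hc (fun _ => hmax _) (fun _ => hmax _) hu hv hu' hv' huv huv' hne

theorem lagrangePoly_triangles_le {w : Finset V → ℝ} (hw : ∀ e, 0 ≤ w e) :
    lagrangePoly (cycleSystem V 3) w ≤ 1 / 27 * (∑ e, w e) ^ 3 :=
  lagrangePoly_le (by norm_num) (fun _ => card_of_mem_cycleSystem (by norm_num))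
    (fun v hv hs e he => (lagrangeLink_triangle_le hv hs he).trans (by norm_num)) hw

theorem lagrangePoly_fourCycles_le {w : Finset V → ℝ} (hw : ∀ e, 0 ≤ w e) :
    lagrangePoly (cycleSystem V 4) w ≤ 1 / 256 * (∑ e, w e) ^ 4 :=
  lagrangePoly_le (by norm_num) (fun _ => card_of_mem_cycleSystem (by norm_num))
    (fun v hv hs e he => (lagrangeLink_fourCycle_le hv hs he).trans (by norm_num)) hw

end

/-! ### Counting closed walks and transversals -/

section

variable {V : Type*}

open Fin.NatCast in
/-- Closed walks with `2 * (r + 1)` steps whose first step is in `D`, counted through every other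
step. -/
theorem card_closedWalks_le_of_first_mem [Fintype V] {G : SimpleGraph V} (r : ℕ)
    (D : Finset (V × V)) (F : Finset (Fin (2 * (r + 1)) → V))
    (hF : ∀ f ∈ F, (∀ i, G.Adj (f i) (f (i + 1))) ∧ (f 0, f 1) ∈ D) :
    F.card ≤ D.card * (G.dartsIn Finset.univ).card ^ r := by
  have hpow : (G.dartsIn Finset.univ).card ^ r
      = (Fintype.piFinset fun _ : Fin r => G.dartsIn Finset.univ).card := by
    simp [Fintype.card_piFinset]
  rw [hpow, ← Finset.card_product]
  refine Finset.card_le_card_of_injOn (fun f => ((f 0, f 1), fun i : Fin r =>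
    (f ((2 * i + 2 : ℕ) : Fin (2 * (r + 1))), f ((2 * i + 3 : ℕ) : Fin (2 * (r + 1)))))) ?_ ?_
  · intro f hf
    obtain ⟨h1, h2⟩ := hF f hf
    simp only [Finset.coe_product, Set.mem_prod, Finset.mem_coe, Fintype.mem_piFinset,
      SimpleGraph.mem_dartsIn, Finset.mem_univ, true_and]
    refine ⟨h2, fun i => ?_⟩
    have := h1 ((2 * i + 2 : ℕ) : Fin (2 * (r + 1)))
    rwa [← Nat.cast_succ] at this
  · intro f _ g _ h
    simp only [Prod.mk.injEq, funext_iff] at h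
    obtain ⟨⟨h0, h1⟩, h⟩ := h
    funext x
    rw [← Fin.cast_val_eq_self x]
    have hx := x.2
    rcases Nat.even_or_odd' x.val with ⟨j, hj | hj⟩
    · rcases Nat.eq_zero_or_pos j with rfl | hj0
      · rw [hj]; simpa using h0
      · have := (h ⟨j - 1, by omega⟩).1
        rwa [show 2 * (j - 1) + 2 = x.val by omega] at this
    · rcases Nat.eq_zero_or_pos j with rfl | hj0
      · rw [hj]; simpa using h1
      · have := (h ⟨j - 1, by omega⟩).2
        rwa [show 2 * (j - 1) + 3 = x.val by omega] at this

open Fin.NatCast in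
/-- Closed walks with `2 * (r + 1)` steps whose first two vertices have small degree: after `r`
independent steps between the other vertices have been chosen, there are at most `k` choices for
the first and at most `k` choices for the last vertex. -/
theorem card_closedWalks_le_of_first_small [Fintype V] {G : SimpleGraph V} {r : ℕ}
    (hr : r ≠ 0) (k : ℕ) (S : Finset V) (hS : ∀ s ∈ S, (G.nbrsIn Finset.univ s).card ≤ k)
    (F : Finset (Fin (2 * (r + 1)) → V))
    (hF : ∀ f ∈ F, (∀ i, G.Adj (f i) (f (i + 1))) ∧ f 0 ∈ S ∧ f 1 ∈ S) :
    F.card ≤ (G.dartsIn Finset.univ).card ^ r * k ^ 2 := by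
  classical
  -- an enumeration of the neighbours of each vertex
  have hν : ∀ s : V, ∃ ν : V → ℕ, (∀ x, G.Adj s x → ν x < (G.nbrsIn Finset.univ s).card) ∧
      ∀ x y, G.Adj s x → G.Adj s y → ν x = ν y → x = y := by
    intro s
    have hm : ∀ x, G.Adj s x → x ∈ G.nbrsIn Finset.univ s := fun x hx =>
      SimpleGraph.mem_nbrsIn.2 ⟨Finset.mem_univ x, hx⟩
    refine ⟨fun x => if h : x ∈ G.nbrsIn Finset.univ s
      then ((G.nbrsIn Finset.univ s).equivFin ⟨x, h⟩ : ℕ) else 0, ?_, ?_⟩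
    · intro x hx
      simp only [dif_pos (hm x hx)]
      exact Fin.is_lt _
    · intro x y hx hy h
      simp only [dif_pos (hm x hx), dif_pos (hm y hy)] at h
      simpa using (G.nbrsIn Finset.univ s).equivFin.injective (Fin.ext h)
  choose ν hν1 hν2 using hν
  have hpow : (G.dartsIn Finset.univ).card ^ r
      = (Fintype.piFinset fun _ : Fin r => G.dartsIn Finset.univ).card := by
    simp [Fintype.card_piFinset]
  have hk : k ^ 2 = (Finset.range k ×ˢ Finset.range k).card := by
    rw [Finset.card_product, Finset.card_range, pow_two]
  rw [hpow, hk, ← Finset.card_product]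
  have hlast : ∀ f : Fin (2 * (r + 1)) → V, (∀ i, G.Adj (f i) (f (i + 1))) →
      G.Adj (f 0) (f ((2 * r + 1 : ℕ) : Fin (2 * (r + 1)))) := by
    intro f hf
    have := (hf ((2 * r + 1 : ℕ) : Fin (2 * (r + 1)))).symm
    rwa [← Nat.cast_succ, show (2 * r + 1).succ = 2 * (r + 1) by omega, Fin.natCast_self] at this
  refine Finset.card_le_card_of_injOn (fun f => ((fun i : Fin r =>
    (f ((2 * i + 1 : ℕ) : Fin (2 * (r + 1))), f ((2 * i + 2 : ℕ) : Fin (2 * (r + 1))))),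
    (ν (f 1) (f 0), ν (f 0) (f ((2 * r + 1 : ℕ) : Fin (2 * (r + 1))))))) ?_ ?_
  · intro f hf
    obtain ⟨h1, h2, h3⟩ := hF f hf
    simp only [Finset.coe_product, Set.mem_prod, Finset.mem_coe, Fintype.mem_piFinset,
      SimpleGraph.mem_dartsIn, Finset.mem_univ, true_and, Finset.mem_range]
    refine ⟨fun i => ?_, ?_, ?_⟩
    · have := h1 ((2 * i + 1 : ℕ) : Fin (2 * (r + 1)))
      rwa [← Nat.cast_succ] at this
    · have h10 := (h1 0).symm
      rw [zero_add] at h10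
      exact (hν1 _ _ h10).trans_le (hS _ h3)
    · exact (hν1 _ _ (hlast f h1)).trans_le (hS _ h2)
  · intro f hf g hg h
    simp only [Prod.mk.injEq, funext_iff] at h
    obtain ⟨h, h0, h1⟩ := h
    have hf1 := (hF f hf).1
    have hg1 := (hF g hg).1
    have e1 : f 1 = g 1 := by
      have := (h ⟨0, by omega⟩).1
      simpa using this
    have e0 : f 0 = g 0 := by
      have hf10 := (hf1 0).symm
      have hg10 := (hg1 0).symm
      rw [zero_add] at hf10 hg10
      rw [e1] at h0 hf10
      exact hν2 _ _ _ hf10 hg10 h0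
    have e2 : f ((2 * r + 1 : ℕ) : Fin (2 * (r + 1))) = g ((2 * r + 1 : ℕ) : Fin (2 * (r + 1))) := by
      have hfl := hlast f hf1
      rw [e0] at h1 hfl
      exact hν2 _ _ _ hfl (hlast g hg1) h1
    funext x
    rw [← Fin.cast_val_eq_self x]
    have hx := x.2
    rcases Nat.even_or_odd' x.val with ⟨j, hj | hj⟩
    · rcases Nat.eq_zero_or_pos j with rfl | hj0
      · rw [hj]; simpa using e0
      · have := (h ⟨j - 1, by omega⟩).2
        rwa [show 2 * (j - 1) + 2 = x.val by omega] at this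
    · by_cases hjr : j = r
      · subst hjr
        rwa [hj]
      · have := (h ⟨j, by omega⟩).1
        rwa [← hj] at this

/-- Subsets on which a labelling `ℓ` is injective with image in `𝓗` are counted by the Lagrange
polynomial of `𝓗` at the sizes of the label classes. -/
theorem card_transversals_le_lagrangePoly {E : Type*} [DecidableEq E] [DecidableEq V]
    (S : Finset V) (ℓ : V → E)
    {𝓗 : Finset (Finset E)} {m : ℕ} (hm : ∀ H ∈ 𝓗, H.card = m) (F : Finset (Finset V))
    (hF : ∀ T ∈ F, T ⊆ S ∧ T.card = m ∧ T.image ℓ ∈ 𝓗) :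
    (F.card : ℝ) ≤ lagrangePoly 𝓗 fun e => ((S.filter fun s => ℓ s = e).card : ℝ) := by
  have h1 : F.card ≤ ∑ H ∈ 𝓗, ∏ e ∈ H, (S.filter fun s => ℓ s = e).card := by
    rw [Finset.card_eq_sum_card_fiberwise (f := fun T => T.image ℓ) (t := 𝓗)
      (fun T hT => (hF T hT).2.2)]
    refine Finset.sum_le_sum fun H hH => ?_
    rw [← Finset.card_pi]
    refine (Finset.card_le_card (t := (H.pi fun e => S.filter fun s => ℓ s = e).image
      fun p => H.attach.image fun e => p e.1 e.2) ?_).trans Finset.card_image_le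
    intro T hT
    obtain ⟨hTF, hTH⟩ := Finset.mem_filter.1 hT
    obtain ⟨hTS, hTm, -⟩ := hF T hTF
    have hsec : ∀ e : E, ∀ he : e ∈ H, ∃ s ∈ T, ℓ s = e := fun e he =>
      Finset.mem_image.1 (hTH ▸ he)
    choose p hp1 hp2 using hsec
    refine Finset.mem_image.2 ⟨p, Finset.mem_pi.2 fun e he =>
      Finset.mem_filter.2 ⟨hTS (hp1 e he), hp2 e he⟩, ?_⟩
    refine Finset.eq_of_subset_of_card_le ?_ ?_
    · intro s hs
      obtain ⟨e, -, rfl⟩ := Finset.mem_image.1 hs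
      exact hp1 _ _
    · rw [Finset.card_image_of_injective, Finset.card_attach, hm H hH, hTm]
      intro e e' h
      have h1 := hp2 e.1 e.2
      simp only at h
      rw [h, hp2] at h1
      exact Subtype.ext h1.symm
  rw [lagrangePoly]
  exact_mod_cast h1

end

/-! ### Copies of even cycles -/

section

open SimpleGraph

variable {V W : Type*}

theorem SimpleGraph.Copy.toSubgraph_adj_iff {G : SimpleGraph V} {H : SimpleGraph W} (φ : Copy H G)
    (x y : V) : φ.toSubgraph.Adj x y ↔ ∃ u v, H.Adj u v ∧ φ u = x ∧ φ v = y := by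
  simp [Copy.toSubgraph, Relation.Map]

theorem SimpleGraph.Copy.mem_verts_toSubgraph_iff {G : SimpleGraph V} {H : SimpleGraph W}
    (φ : Copy H G) (x : V) : x ∈ φ.toSubgraph.verts ↔ ∃ u, φ u = x := by
  simp [Copy.toSubgraph]

theorem cycleGraph_adj_iff {N : ℕ} [NeZero N] (hN : 2 ≤ N) {i j : Fin N} :
    (cycleGraph N).Adj i j ↔ i = j + 1 ∨ j = i + 1 := by
  obtain ⟨n, rfl⟩ := Nat.exists_eq_add_of_le' hN
  rw [cycleGraph_adj, sub_eq_iff_eq_add', sub_eq_iff_eq_add', add_comm j 1, add_comm i 1,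
    add_comm 1 j, add_comm 1 i]

/-- Rotating the labels of a copy of a cycle does not change the subgraph. -/
theorem exists_rotated_copy {G : SimpleGraph V} {N : ℕ} [NeZero N] (hN : 2 ≤ N)
    (φ : Copy (cycleGraph N) G) (i : Fin N) :
    ∃ ψ : Copy (cycleGraph N) G, ψ.toSubgraph = φ.toSubgraph ∧ ∀ j, ψ j = φ (j + i) := by
  let ρ : Copy (cycleGraph N) (cycleGraph N) :=
    ⟨⟨fun j => j + i, fun {a b} h => by
      rw [cycleGraph_adj_iff hN] at h ⊢
      rcases h with rfl | rfl
      · exact Or.inl (add_right_comm _ _ _)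
      · exact Or.inr (add_right_comm _ _ _)⟩, add_left_injective i⟩
  have hρ : ∀ j, (φ.comp ρ) j = φ (j + i) := fun j => Copy.comp_apply _ _ _
  refine ⟨φ.comp ρ, ?_, hρ⟩
  ext x y
  · rw [Copy.mem_verts_toSubgraph_iff, Copy.mem_verts_toSubgraph_iff]
    constructor
    · rintro ⟨u, rfl⟩
      exact ⟨u + i, (hρ u).symm⟩
    · rintro ⟨u, rfl⟩
      exact ⟨u - i, by rw [hρ, sub_add_cancel]⟩
  · rw [Copy.toSubgraph_adj_iff, Copy.toSubgraph_adj_iff]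
    simp only [cycleGraph_adj_iff hN]
    constructor
    · rintro ⟨u, v, h, rfl, rfl⟩
      refine ⟨u + i, v + i, ?_, (hρ u).symm, (hρ v).symm⟩
      rcases h with rfl | rfl
      · exact Or.inl (add_right_comm _ _ _)
      · exact Or.inr (add_right_comm _ _ _)
    · rintro ⟨u, v, h, rfl, rfl⟩
      refine ⟨u - i, v - i, ?_, by rw [hρ, sub_add_cancel], by rw [hρ, sub_add_cancel]⟩
      rcases h with rfl | rfl
      · exact Or.inl (add_sub_right_comm _ _ _)
      · exact Or.inr (add_sub_right_comm _ _ _)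

theorem SimpleGraph.Copy.adj_succ {G : SimpleGraph V} {N : ℕ} [NeZero N] (hN : 2 ≤ N)
    (φ : Copy (cycleGraph N) G) (i : Fin N) : G.Adj (φ i) (φ (i + 1)) :=
  φ.toHom.map_adj ((cycleGraph_adj_iff hN).2 (Or.inr rfl))

open Classical in
/-- The vertices of `S` with at least three neighbours outside `S`. -/
noncomputable def SimpleGraph.branchVertices [Fintype V] (G : SimpleGraph V) (S : Finset V) :
    Finset V :=
  S.filter fun s => 3 ≤ (G.nbrsIn Sᶜ s).card

open Classical Fin.NatCast in
/-- If no labelling of a `2m`-cycle starts with an edge inside `S` or inside the union of `Sᶜ` and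
the branch vertices, then the cycle alternates between `Sᶜ` and `S`, and every second vertex has
exactly its two neighbours on the cycle as neighbours in `Sᶜ`. -/
theorem alternating_of_no_exceptional_edge [Fintype V] {G : SimpleGraph V} {m : ℕ} [NeZero m]
    [NeZero (2 * m)] (hm : 3 ≤ m) (S : Finset V) {C : G.Subgraph}
    (hC : ∃ φ : Copy (cycleGraph (2 * m)) G, φ.toSubgraph = C)
    (h1 : ∀ φ : Copy (cycleGraph (2 * m)) G, φ.toSubgraph = C → ¬ (φ 0 ∈ S ∧ φ 1 ∈ S))
    (h2 : ∀ φ : Copy (cycleGraph (2 * m)) G, φ.toSubgraph = C →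
      ¬ (φ 0 ∈ Sᶜ ∪ G.branchVertices S ∧ φ 1 ∈ Sᶜ ∪ G.branchVertices S)) :
    ∃ X : Finset V, X ⊆ S ∧ X.card = m ∧ X.image (G.nbrsIn Sᶜ) ∈ cycleSystem V m ∧
      ∀ x y, C.Adj x y ↔ (x ∈ X ∧ y ∈ G.nbrsIn Sᶜ x) ∨ (y ∈ X ∧ x ∈ G.nbrsIn Sᶜ y) := by
  have hN : 2 ≤ 2 * m := by omega
  have rot1 : ∀ φ : Copy (cycleGraph (2 * m)) G, φ.toSubgraph = C → ∀ i,
      ¬ (φ i ∈ S ∧ φ (i + 1) ∈ S) := by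
    intro φ hφ i
    obtain ⟨ψ, hψ, h⟩ := exists_rotated_copy hN φ i
    have := h1 ψ (hψ.trans hφ)
    rwa [h, h, zero_add, add_comm 1 i] at this
  have rot2 : ∀ φ : Copy (cycleGraph (2 * m)) G, φ.toSubgraph = C → ∀ i,
      ¬ (φ i ∈ Sᶜ ∪ G.branchVertices S ∧ φ (i + 1) ∈ Sᶜ ∪ G.branchVertices S) := by
    intro φ hφ i
    obtain ⟨ψ, hψ, h⟩ := exists_rotated_copy hN φ i
    have := h2 ψ (hψ.trans hφ)
    rwa [h, h, zero_add, add_comm 1 i] at this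
  obtain ⟨φ, hφ, h0⟩ : ∃ φ : Copy (cycleGraph (2 * m)) G, φ.toSubgraph = C ∧ φ 0 ∉ S := by
    obtain ⟨φ, hφ⟩ := hC
    by_cases h : φ 0 ∈ S
    · obtain ⟨ψ, hψ, hr⟩ := exists_rotated_copy hN φ 1
      refine ⟨ψ, hψ.trans hφ, fun h' => h1 φ hφ ⟨h, ?_⟩⟩
      rwa [hr, zero_add] at h'
    · exact ⟨φ, hφ, h⟩
  have r1 := rot1 φ hφ
  have r2 := rot2 φ hφ
  have hcompl : ∀ {x}, x ∉ S → x ∈ Sᶜ ∪ G.branchVertices S := fun hx =>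
    Finset.mem_union_left _ (Finset.mem_compl.2 hx)
  have step : ∀ i, φ i ∉ S → φ (i + 1) ∈ S := by
    intro i hi
    by_contra h
    exact r2 i ⟨hcompl hi, hcompl h⟩
  have step' : ∀ i, φ i ∈ S → φ (i + 1) ∉ S := fun i hi h => r1 i ⟨hi, h⟩
  have heven : ∀ j : ℕ, φ ((2 * j : ℕ) : Fin (2 * m)) ∉ S := by
    intro j
    induction j with
    | zero => simpa using h0
    | succ j ih =>
      have := step' _ (step _ ih)
      rwa [← Nat.cast_succ, ← Nat.cast_succ] at this
  have hodd : ∀ j : ℕ, φ ((2 * j + 1 : ℕ) : Fin (2 * m)) ∈ S := by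
    intro j
    have := step _ (heven j)
    rwa [← Nat.cast_succ] at this
  have hinj : ∀ a b : ℕ, a < 2 * m → b < 2 * m → φ (a : Fin (2 * m)) = φ (b : Fin (2 * m)) →
      a = b := by
    intro a b ha hb h
    have := congrArg Fin.val (φ.injective h)
    rwa [Fin.val_cast_of_lt ha, Fin.val_cast_of_lt hb] at this
  let b : Fin m → V := fun i => φ ((2 * i.val : ℕ) : Fin (2 * m))
  let s : Fin m → V := fun i => φ ((2 * i.val + 1 : ℕ) : Fin (2 * m))
  have hb : Function.Injective b := by
    intro i j h
    have := hinj _ _ (by omega) (by omega) h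
    exact Fin.ext (by omega)
  have hs : Function.Injective s := by
    intro i j h
    have := hinj _ _ (by omega) (by omega) h
    exact Fin.ext (by omega)
  have hbs : ∀ i : Fin m, b (i + 1) = φ ((2 * i.val + 1 + 1 : ℕ) : Fin (2 * m)) := by
    intro i
    have : ((2 * (i + 1 : Fin m).val : ℕ) : Fin (2 * m)) = ((2 * i.val + 1 + 1 : ℕ) : Fin (2 * m)) := by
      apply Fin.ext
      rw [Fin.val_natCast, Fin.val_natCast, Fin.val_add, Fin.val_one',
        show 2 * i.val + 1 + 1 = 2 * (i.val + 1) by ring, Nat.mul_mod_mul_left,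
        Nat.mul_mod_mul_left, Nat.mod_mod, Nat.add_mod_mod]
    simp only [b, this]
  have hadj1 : ∀ i, G.Adj (s i) (b i) := by
    intro i
    have := φ.adj_succ hN ((2 * i.val : ℕ) : Fin (2 * m))
    rw [← Nat.cast_succ] at this
    exact this.symm
  have hadj2 : ∀ i, G.Adj (s i) (b (i + 1)) := by
    intro i
    have := φ.adj_succ hN ((2 * i.val + 1 : ℕ) : Fin (2 * m))
    rw [← Nat.cast_succ] at this
    rw [hbs]
    exact this
  have hbS : ∀ i, b i ∈ Sᶜ := fun i => Finset.mem_compl.2 (heven _)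
  have hnbrs : ∀ i, G.nbrsIn Sᶜ (s i) = {b i, b (i + 1)} := by
    intro i
    have hne : b i ≠ b (i + 1) := by
      intro h
      have h' := hb h
      have h3 : (1 : Fin m) = 0 := by simpa using h'.symm
      have h4 := congrArg Fin.val h3
      rw [Fin.val_one', Fin.val_zero, Nat.mod_eq_of_lt (by omega)] at h4
      omega
    have hbr : s i ∉ G.branchVertices S := by
      intro h
      have := r2 ((2 * i.val : ℕ) : Fin (2 * m))
      rw [← Nat.cast_succ] at this
      exact this ⟨hcompl (heven _), Finset.mem_union_right _ h⟩
    symm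
    refine Finset.eq_of_subset_of_card_le ?_ ?_
    · intro x hx
      simp only [Finset.mem_insert, Finset.mem_singleton] at hx
      rcases hx with rfl | rfl
      · exact SimpleGraph.mem_nbrsIn.2 ⟨hbS _, hadj1 i⟩
      · exact SimpleGraph.mem_nbrsIn.2 ⟨hbS _, hadj2 i⟩
    · rw [Finset.card_pair hne]
      by_contra hlt
      exact hbr (Finset.mem_filter.2 ⟨hodd _, by omega⟩)
  refine ⟨Finset.univ.image s, ?_, ?_, ?_, ?_⟩
  · intro x hx
    obtain ⟨i, -, rfl⟩ := Finset.mem_image.1 hx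
    exact hodd _
  · rw [Finset.card_image_of_injective _ hs, Finset.card_univ, Fintype.card_fin]
  · rw [mem_cycleSystem]
    refine ⟨b, hb, ?_⟩
    rw [Finset.image_image]
    refine Finset.image_congr fun i _ => ?_
    exact (hnbrs i).symm
  · have hCadj : ∀ i, C.Adj (s i) (b i) ∧ C.Adj (s i) (b (i + 1)) := by
      intro i
      rw [← hφ, hbs, Copy.toSubgraph_adj_iff, Copy.toSubgraph_adj_iff]
      exact ⟨⟨_, _, (cycleGraph_adj_iff hN).2 (Or.inl (Nat.cast_succ _)), rfl, rfl⟩,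
        ⟨_, _, (cycleGraph_adj_iff hN).2 (Or.inr (Nat.cast_succ _)), rfl, rfl⟩⟩
    have back : ∀ x y, x ∈ Finset.univ.image s → y ∈ G.nbrsIn Sᶜ x → C.Adj x y := by
      intro x y hx hy
      obtain ⟨i, -, rfl⟩ := Finset.mem_image.1 hx
      rw [hnbrs, Finset.mem_insert, Finset.mem_singleton] at hy
      rcases hy with rfl | rfl
      · exact (hCadj i).1
      · exact (hCadj i).2
    have forth : ∀ u : Fin (2 * m), (φ u ∈ Finset.univ.image s ∧ φ (u + 1) ∈ G.nbrsIn Sᶜ (φ u)) ∨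
        (φ (u + 1) ∈ Finset.univ.image s ∧ φ u ∈ G.nbrsIn Sᶜ (φ (u + 1))) := by
      intro u
      have hadj := φ.adj_succ hN u
      have hu := u.2
      rw [← Fin.cast_val_eq_self u] at hadj ⊢
      rw [← Nat.cast_succ] at hadj ⊢
      rcases Nat.even_or_odd' u.val with ⟨j, hj | hj⟩
      · rw [hj] at hadj ⊢
        exact Or.inr ⟨Finset.mem_image.2 ⟨⟨j, by omega⟩, Finset.mem_univ _, rfl⟩,
          SimpleGraph.mem_nbrsIn.2 ⟨Finset.mem_compl.2 (heven j), hadj.symm⟩⟩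
      · rw [hj] at hadj ⊢
        exact Or.inl ⟨Finset.mem_image.2 ⟨⟨j, by omega⟩, Finset.mem_univ _, rfl⟩,
          SimpleGraph.mem_nbrsIn.2 ⟨Finset.mem_compl.2 (heven (j + 1)), hadj⟩⟩
    intro x y
    constructor
    · intro h
      rw [← hφ, Copy.toSubgraph_adj_iff] at h
      obtain ⟨u, v, huv, rfl, rfl⟩ := h
      rcases (cycleGraph_adj_iff hN).1 huv with rfl | rfl
      · exact (forth v).symm
      · exact forth u
    · rintro (⟨h, h'⟩ | ⟨h, h'⟩)
      · exact back x y h h'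
      · exact (back y x h h').symm

open Classical in
/-- Apart from the copies of the `2m`-cycle with an exceptional edge, which are counted as closed
walks, distinct copies have distinct sets of vertices in `S`; these sets are collected in `F`. -/
theorem copyCount_cycleGraph_le [Fintype V] (G : SimpleGraph V) {r : ℕ} (hr : 2 ≤ r) (k : ℕ)
    (S : Finset V) (hS : ∀ s ∈ S, (G.nbrsIn Finset.univ s).card ≤ k) :
    ∃ F : Finset (Finset V), (∀ X ∈ F, X ⊆ S ∧ X.card = r + 1 ∧
        X.image (G.nbrsIn Sᶜ) ∈ cycleSystem V (r + 1)) ∧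
      G.copyCount (cycleGraph (2 * (r + 1))) ≤ (G.dartsIn Finset.univ).card ^ r * k ^ 2 +
        (G.dartsIn (Sᶜ ∪ G.branchVertices S)).card * (G.dartsIn Finset.univ).card ^ r + F.card := by
  have hN : 2 ≤ 2 * (r + 1) := by omega
  rw [copyCount_eq_card_image_copyToSubgraph]
  set 𝒞 := (Finset.univ : Finset (Copy (cycleGraph (2 * (r + 1))) G)).image Copy.toSubgraph
  have h𝒞 : ∀ C ∈ 𝒞, ∃ φ : Copy (cycleGraph (2 * (r + 1))) G, φ.toSubgraph = C := by
    intro C hC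
    obtain ⟨φ, -, h⟩ := Finset.mem_image.1 hC
    exact ⟨φ, h⟩
  -- subgraphs with a labelling of a given kind are not more than such labellings
  have count : ∀ P : Copy (cycleGraph (2 * (r + 1))) G → Prop,
      (𝒞.filter fun C => ∃ φ, φ.toSubgraph = C ∧ P φ).card ≤
        ((Finset.univ.filter P).image fun φ : Copy (cycleGraph (2 * (r + 1))) G =>
          (fun i => φ i : Fin (2 * (r + 1)) → V)).card := by
    intro P
    rw [Finset.card_image_of_injective _ (fun φ ψ h => Copy.ext fun i => congrFun h i)]
    refine (Finset.card_le_card (t := (Finset.univ.filter P).image Copy.toSubgraph) ?_).trans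
      Finset.card_image_le
    intro C hC
    obtain ⟨-, φ, rfl, hP⟩ := Finset.mem_filter.1 hC
    exact Finset.mem_image_of_mem _ (Finset.mem_filter.2 ⟨Finset.mem_univ _, hP⟩)
  obtain ⟨P1, hP1⟩ : ∃ P : Copy (cycleGraph (2 * (r + 1))) G → Prop,
      ∀ φ, P φ ↔ (φ 0 ∈ S ∧ φ 1 ∈ S) := ⟨_, fun _ => Iff.rfl⟩
  obtain ⟨P2, hP2⟩ : ∃ P : Copy (cycleGraph (2 * (r + 1))) G → Prop,
      ∀ φ, P φ ↔ (φ 0 ∈ Sᶜ ∪ G.branchVertices S ∧ φ 1 ∈ Sᶜ ∪ G.branchVertices S) :=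
    ⟨_, fun _ => Iff.rfl⟩
  have c1 := (count P1).trans (card_closedWalks_le_of_first_small (G := G) (r := r) (by omega) k S hS _
    (by
      intro f hf
      obtain ⟨φ, hφ, rfl⟩ := Finset.mem_image.1 hf
      exact ⟨φ.adj_succ hN, (hP1 φ).1 (Finset.mem_filter.1 hφ).2⟩))
  have c2 := (count P2).trans (card_closedWalks_le_of_first_mem (G := G) r
    (G.dartsIn (Sᶜ ∪ G.branchVertices S)) _
    (by
      intro f hf
      obtain ⟨φ, hφ, rfl⟩ := Finset.mem_image.1 hf
      have h := (hP2 φ).1 (Finset.mem_filter.1 hφ).2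
      have h01 := φ.adj_succ hN 0
      rw [zero_add] at h01
      exact ⟨φ.adj_succ hN, SimpleGraph.mem_dartsIn.2 ⟨h.1, h.2, h01⟩⟩))
  set 𝒜 := 𝒞.filter fun C => ∃ φ : Copy (cycleGraph (2 * (r + 1))) G, φ.toSubgraph = C ∧ P1 φ
  set ℬ := 𝒞.filter fun C => ∃ φ : Copy (cycleGraph (2 * (r + 1))) G, φ.toSubgraph = C ∧ P2 φ
  set 𝒢 := 𝒞 \ (𝒜 ∪ ℬ)
  have hgood : ∀ C ∈ 𝒢, ∃ X : Finset V, X ⊆ S ∧ X.card = r + 1 ∧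
      X.image (G.nbrsIn Sᶜ) ∈ cycleSystem V (r + 1) ∧
      ∀ x y, C.Adj x y ↔ (x ∈ X ∧ y ∈ G.nbrsIn Sᶜ x) ∨ (y ∈ X ∧ x ∈ G.nbrsIn Sᶜ y) := by
    intro C hC
    obtain ⟨hC, hnot⟩ := Finset.mem_sdiff.1 hC
    have h1 : ¬ ∃ φ : Copy (cycleGraph (2 * (r + 1))) G, φ.toSubgraph = C ∧ P1 φ := fun h =>
      hnot (Finset.mem_union_left _ (Finset.mem_filter.2 ⟨hC, h⟩))
    have h2 : ¬ ∃ φ : Copy (cycleGraph (2 * (r + 1))) G, φ.toSubgraph = C ∧ P2 φ := fun h =>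
      hnot (Finset.mem_union_right _ (Finset.mem_filter.2 ⟨hC, h⟩))
    exact alternating_of_no_exceptional_edge (by omega) S (h𝒞 C hC)
      (fun φ hφ h => h1 ⟨φ, hφ, (hP1 φ).2 h⟩) (fun φ hφ h => h2 ⟨φ, hφ, (hP2 φ).2 h⟩)
  choose! X hX1 hX2 hX3 hX4 using hgood
  refine ⟨𝒢.image X, ?_, ?_⟩
  · intro Y hY
    obtain ⟨C, hC, rfl⟩ := Finset.mem_image.1 hY
    exact ⟨hX1 C hC, hX2 C hC, hX3 C hC⟩
  · have hcard : (𝒢.image X).card = 𝒢.card := by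
      refine Finset.card_image_of_injOn ?_
      intro C hC C' hC' h
      have hadj : ∀ x y, C.Adj x y ↔ C'.Adj x y := by
        intro x y
        rw [hX4 C hC, hX4 C' hC', h]
      have hverts : ∀ D ∈ 𝒞, ∀ x, x ∈ D.verts ↔ ∃ y, D.Adj x y := by
        intro D hD x
        obtain ⟨φ, rfl⟩ := h𝒞 D hD
        constructor
        · intro hx
          obtain ⟨u, rfl⟩ := (φ.mem_verts_toSubgraph_iff x).1 hx
          exact ⟨φ (u + 1), (φ.toSubgraph_adj_iff _ _).2
            ⟨u, u + 1, (cycleGraph_adj_iff hN).2 (Or.inr rfl), rfl, rfl⟩⟩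
        · rintro ⟨y, hy⟩
          exact hy.fst_mem
      ext x y
      · rw [hverts C (Finset.mem_sdiff.1 hC).1, hverts C' (Finset.mem_sdiff.1 hC').1]
        simp only [hadj]
      · exact hadj x y
    have h1 : 𝒞.card ≤ 𝒢.card + (𝒜 ∪ ℬ).card := Finset.card_le_card_sdiff_add_card
    have h2 := Finset.card_union_le 𝒜 ℬ
    calc 𝒞.card ≤ (𝒜.card + ℬ.card) + 𝒢.card := by linarith
      _ ≤ _ := by rw [hcard]; exact Nat.add_le_add_right (Nat.add_le_add c1 c2) _

end

/-! ### Planar blow-ups of cycles -/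

section

open SimpleGraph

/-- The cycle on `m` vertices in which each edge is replaced by several paths of length two. The
middle vertex `j` joins the base vertices `j % m` and `j % m + 1`. The vertex set is any type `U`
that is identified with the sum of `Fin m` (the base vertices) and `Fin N` (the middle vertices). -/
def blowUpCycle {U : Type*} (m N : ℕ) [NeZero m] (e : U ≃ Fin m ⊕ Fin N) : SimpleGraph U :=
  SimpleGraph.comap e
    { Adj := fun x y => match x, y with
        | .inl i, .inr j => i = Fin.ofNat m j ∨ i = Fin.ofNat m j + 1
        | .inr j, .inl i => i = Fin.ofNat m j ∨ i = Fin.ofNat m j + 1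
        | _, _ => False
      symm := ⟨by rintro (i | j) (i' | j') h <;> exact h⟩
      loopless := ⟨by rintro (i | j) h <;> exact h⟩ }

/-- If the cones spanned by consecutive vectors `D i`, `D (i + 1)` do not overlap, then the blown-up
cycle has a straight-line drawing: the base vertex `i` is placed at `D i`, and the middle vertices
between `i` and `i + 1` are placed on the open half-line through `D i + D (i + 1)`. -/
theorem isPlanar_blowUpCycle {U : Type*} {m N : ℕ} [NeZero m] (e : U ≃ Fin m ⊕ Fin N)
    (D : Fin m → Plane) (hD : Function.Injective D)
    (cone : ∀ c c' : Fin m, ∀ α β α' β' : ℝ, 0 < α → 0 < β → 0 ≤ α' → 0 ≤ β' →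
      α • D c + β • D (c + 1) = α' • D c' + β' • D (c' + 1) → c = c' ∧ α = α' ∧ β = β') :
    IsPlanar (blowUpCycle m N e) := by
  let τ : Fin N → ℝ := fun j => 1 / ((j : ℝ) + 3)
  have τ0 : ∀ j, 0 < τ j := fun j => by positivity
  have τinj : ∀ j j', τ j = τ j' → j = j' := by
    intro j j' h
    have h1 : ((j : ℝ) + 3) = (j' : ℝ) + 3 := by simpa [τ] using h
    exact Fin.ext (by exact_mod_cast add_right_cancel h1)
  let p : Fin m ⊕ Fin N → Plane := Sum.elim D
    fun j => τ j • D (Fin.ofNat m j) + τ j • D (Fin.ofNat m j + 1)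
  have hpl : ∀ i, p (.inl i) = (1 : ℝ) • D i + (0 : ℝ) • D (i + 1) := fun i => by simp [p]
  have hedge : ∀ x : (blowUpCycle m N e).edgeSet, ∃ (i : Fin m) (j : Fin N),
      s(e.symm (.inl i), e.symm (.inr j)) = (x : Sym2 U) ∧
        (i = Fin.ofNat m j ∨ i = Fin.ofNat m j + 1) := by
    rintro ⟨x, hx⟩
    induction x using Sym2.ind with
    | _ u v =>
      rw [mem_edgeSet] at hx
      obtain ⟨u, rfl⟩ := e.symm.surjective u
      obtain ⟨v, rfl⟩ := e.symm.surjective v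
      simp only [blowUpCycle, comap_adj, Equiv.apply_symm_apply] at hx
      rcases u with i | j <;> rcases v with i' | j'
      · exact hx.elim
      · exact ⟨i, j', rfl, hx⟩
      · exact ⟨i', j, Sym2.eq_swap, hx⟩
      · exact hx.elim
  choose b s hbs hcone using hedge
  -- coordinates of the points of an edge with respect to the cone of that edge
  have coord : ∀ x, ∃ side : Bool, b x = (if side then Fin.ofNat m (s x) + 1 else Fin.ofNat m (s x)) ∧
      ∀ r : ℝ, AffineMap.lineMap (p (.inl (b x))) (p (.inr (s x))) r =
        ((if side then 0 else 1 - r) + r * τ (s x)) • D (Fin.ofNat m (s x)) +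
        ((if side then 1 - r else 0) + r * τ (s x)) • D (Fin.ofNat m (s x) + 1) := by
    intro x
    rcases hcone x with h | h
    · refine ⟨false, by simpa using h, fun r => ?_⟩
      rw [AffineMap.lineMap_apply_module, h]
      simp only [p, Sum.elim_inl, Sum.elim_inr, Bool.false_eq_true, if_false]
      module
    · refine ⟨true, by simpa using h, fun r => ?_⟩
      rw [AffineMap.lineMap_apply_module, h]
      simp only [p, Sum.elim_inl, Sum.elim_inr, if_true]
      module
  choose side hside hline using coord
  have pos : ∀ x (r : ℝ), 0 < r → r ≤ 1 → ∀ c : Prop, [Decidable c] →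
      0 < (if c then 0 else 1 - r) + r * τ (s x) ∧ 0 < (if c then 1 - r else 0) + r * τ (s x) := by
    intro x r h0 h1 c _
    have := mul_pos h0 (τ0 (s x))
    split_ifs <;> constructor <;> linarith
  have nonneg : ∀ x (r : ℝ), 0 ≤ r → r ≤ 1 → ∀ c : Prop, [Decidable c] →
      0 ≤ (if c then 0 else 1 - r) + r * τ (s x) ∧ 0 ≤ (if c then 1 - r else 0) + r * τ (s x) := by
    intro x r h0 h1 c _
    have := mul_nonneg h0 (τ0 (s x)).le
    split_ifs <;> constructor <;> linarith
  have pinj : Function.Injective p := by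
    rintro (i | j) (i' | j') h
    · exact congrArg _ (hD h)
    · have h' := h.symm
      rw [hpl] at h'
      have := (cone _ _ _ _ _ _ (τ0 j') (τ0 j') zero_le_one le_rfl h').2.2
      exact absurd this (τ0 j').ne'
    · rw [hpl] at h
      have := (cone _ _ _ _ _ _ (τ0 j) (τ0 j) zero_le_one le_rfl h).2.2
      exact absurd this (τ0 j).ne'
    · exact congrArg _ (τinj _ _ (cone _ _ _ _ _ _ (τ0 j) (τ0 j) (τ0 j').le (τ0 j').le h).2.1)
  refine ⟨{ point := fun u => p (e u)
            arc := fun x => ⟨fun t => AffineMap.lineMap (p (.inl (b x))) (p (.inr (s x))) (t : ℝ),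
              AffineMap.lineMap_continuous.comp continuous_subtype_val⟩
            point_injective := pinj.comp e.injective
            arc_injective := ?_
            arc_ends := ?_
            eq_end_of_arc_eq_point := ?_
            exists_point_of_arc_eq_arc := ?_ }⟩
  · intro x t t' h
    exact Subtype.ext (AffineMap.lineMap_injective ℝ (pinj.ne (by simp)) h)
  · intro x
    rw [← hbs x]
    simp
  · intro x t v h
    have ht0 := t.2.1
    have ht1 := t.2.2
    rcases ht0.eq_or_lt with h0 | h0
    · exact Or.inl (Subtype.ext h0.symm)
    right
    have h : AffineMap.lineMap (p (.inl (b x))) (p (.inr (s x))) (t : ℝ) = p (e v) := h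
    rw [hline] at h
    obtain ⟨h1, h2⟩ := pos x t h0 ht1 (side x = true)
    cases hv : e v with
    | inl i =>
      rw [hv, hpl] at h
      exact absurd (cone _ _ _ _ _ _ h1 h2 zero_le_one le_rfl h).2.2 h2.ne'
    | inr j =>
      rw [hv] at h
      obtain ⟨-, h3, h4⟩ := cone _ _ _ _ _ _ h1 h2 (τ0 j).le (τ0 j).le h
      refine Subtype.ext ?_
      change (t : ℝ) = 1
      split_ifs at h3 h4 <;> linarith
  · intro x y t t' hxy h
    have ht0 := t.2.1
    have ht1 := t.2.2
    have ht0' := t'.2.1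
    have ht1' := t'.2.2
    have h : AffineMap.lineMap (p (.inl (b x))) (p (.inr (s x))) (t : ℝ) =
      AffineMap.lineMap (p (.inl (b y))) (p (.inr (s y))) (t' : ℝ) := h
    change ∃ v, AffineMap.lineMap (p (.inl (b x))) (p (.inr (s x))) (t : ℝ) = p (e v)
    rcases ht0.eq_or_lt with h0 | h0
    · exact ⟨e.symm (.inl (b x)), by rw [← h0]; simp⟩
    rw [hline, hline] at h
    obtain ⟨h1, h2⟩ := pos x t h0 ht1 (side x = true)
    obtain ⟨h1', h2'⟩ := nonneg y t' ht0' ht1' (side y = true)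
    obtain ⟨hc, h3, h4⟩ := cone _ _ _ _ _ _ h1 h2 h1' h2' h
    by_cases hs : side x = side y
    · exfalso
      rw [hs] at h3 h4
      have h5 : (t : ℝ) = t' := by split_ifs at h3 h4 <;> linarith
      have h6 : (t : ℝ) * τ (s x) = t * τ (s y) := by
        rw [← h5] at h3
        linarith
      have h7 := τinj _ _ (mul_left_cancel₀ h0.ne' h6)
      apply hxy
      apply Subtype.ext
      rw [← hbs x, ← hbs y, hside x, hside y, hs, h7]
    · have h5 : (t : ℝ) = 1 := by
        cases hx : side x <;> cases hy : side y <;> simp [hx, hy] at h3 h4 hs <;> linarith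
      exact ⟨e.symm (.inr (s x)), by rw [h5]; simp⟩

theorem isPlanar_blowUpCycle_three {U : Type*} {N : ℕ} (e : U ≃ Fin 3 ⊕ Fin N) :
    IsPlanar (blowUpCycle 3 N e) := by
  refine isPlanar_blowUpCycle e ![!₂[1, 0], !₂[0, 1], !₂[-1, -1]] ?_ ?_
  · intro i j h
    have h0 := congrArg (fun v : Plane => v 0) h
    have h1 := congrArg (fun v : Plane => v 1) h
    fin_cases i <;> fin_cases j <;> first | rfl | (exfalso; revert h0 h1; norm_num)
  · intro c c' α β α' β' hα hβ hα' hβ' h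
    have h0 := congrArg (fun v : Plane => v 0) h
    have h1 := congrArg (fun v : Plane => v 1) h
    clear h
    fin_cases c <;> fin_cases c' <;> simp at h0 h1 ⊢ <;> first | linarith | (constructor <;> linarith)

theorem isPlanar_blowUpCycle_four {U : Type*} {N : ℕ} (e : U ≃ Fin 4 ⊕ Fin N) :
    IsPlanar (blowUpCycle 4 N e) := by
  refine isPlanar_blowUpCycle e ![!₂[1, 0], !₂[0, 1], !₂[-1, 0], !₂[0, -1]] ?_ ?_
  · intro i j h
    have h0 := congrArg (fun v : Plane => v 0) h
    have h1 := congrArg (fun v : Plane => v 1) h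
    fin_cases i <;> fin_cases j <;> first | rfl | (exfalso; revert h0 h1; norm_num)
  · intro c c' α β α' β' hα hβ hα' hβ' h
    have h0 := congrArg (fun v : Plane => v 0) h
    have h1 := congrArg (fun v : Plane => v 1) h
    clear h
    fin_cases c <;> fin_cases c' <;> simp at h0 h1 ⊢ <;> first | linarith | (constructor <;> linarith)

/-- The blown-up cycle contains a `2m`-cycle for each choice of one middle vertex between any two
consecutive base vertices. -/
theorem pow_le_copyCount_blowUpCycle {U : Type*} [Fintype U] {m N k : ℕ} [NeZero m] (hm : 2 ≤ m)
    (hk : m * k ≤ N) (e : U ≃ Fin m ⊕ Fin N) :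
    k ^ m ≤ (blowUpCycle m N e).copyCount (cycleGraph (2 * m)) := by
  classical
  have hN : 2 ≤ 2 * m := by omega
  have : NeZero (2 * m) := ⟨by omega⟩
  have hlt : ∀ (f : Fin m → Fin k) (i : Fin m), m * f i + i < N := by
    intro f i
    have h1 : m * (f i + 1) ≤ m * k := Nat.mul_le_mul_left m (f i).2
    have h2 := i.2
    rw [Nat.mul_add, mul_one] at h1
    omega
  let ix : Fin (2 * m) → Fin m := fun x => ⟨x.val / 2, by omega⟩
  let mid : (Fin m → Fin k) → Fin m → Fin N := fun f i => ⟨m * f i + i, hlt f i⟩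
  have hmid : ∀ f i, Fin.ofNat m (mid f i) = i := by
    intro f i
    apply Fin.ext
    simp only [Fin.ofNat, mid, Nat.mul_add_mod]
    exact Nat.mod_eq_of_lt i.2
  let g : (Fin m → Fin k) → Fin (2 * m) → U := fun f x =>
    if x.val % 2 = 0 then e.symm (.inl (ix x)) else e.symm (.inr (mid f (ix x)))
  have hadj : ∀ f i, (blowUpCycle m N e).Adj (e.symm (.inl i)) (e.symm (.inr (mid f i))) ∧
      (blowUpCycle m N e).Adj (e.symm (.inr (mid f i))) (e.symm (.inl (i + 1))) := by
    intro f i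
    simp only [blowUpCycle, comap_adj, Equiv.apply_symm_apply, hmid]
    simp
  have hstep : ∀ f x, (blowUpCycle m N e).Adj (g f x) (g f (x + 1)) := by
    intro f x
    have hx := x.2
    have hval : (x + 1).val = (x.val + 1) % (2 * m) := by
      rw [Fin.val_add, Fin.val_one', Nat.add_mod_mod]
    by_cases hx2 : x.val % 2 = 0
    · rw [Nat.mod_eq_of_lt (by omega)] at hval
      have h1 : ix (x + 1) = ix x := Fin.ext (by simp only [ix]; omega)
      simp only [g, hx2, if_true, h1]
      rw [if_neg (by omega)]
      exact (hadj f _).1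
    · have h1 : ix (x + 1) = ix x + 1 := by
        apply Fin.ext
        rw [Fin.val_add, Fin.val_one', Nat.add_mod_mod]
        simp only [ix, hval]
        by_cases hl : x.val + 1 = 2 * m
        · rw [hl, Nat.mod_self, show x.val / 2 + 1 = m by omega, Nat.mod_self]
        · rw [Nat.mod_eq_of_lt (show x.val + 1 < 2 * m by omega),
            Nat.mod_eq_of_lt (show x.val / 2 + 1 < m by omega)]
          omega
      have h2 : (x + 1).val % 2 = 0 := by
        rw [hval]
        by_cases hl : x.val + 1 = 2 * m
        · rw [hl, Nat.mod_self]
        · rw [Nat.mod_eq_of_lt (show x.val + 1 < 2 * m by omega)]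
          omega
      simp only [g, hx2, if_false, h2, if_true, h1]
      exact (hadj f _).2
  have hmidinj : ∀ f f' i i', mid f i = mid f' i' → i = i' ∧ f i = f' i' := by
    intro f f' i i' h
    have h1 : i = i' := by rw [← hmid f i, h, hmid]
    subst h1
    refine ⟨rfl, Fin.ext ?_⟩
    have h2 := congrArg Fin.val h
    simp only [mid, Nat.add_right_cancel_iff] at h2
    exact Nat.eq_of_mul_eq_mul_left (by omega) h2
  have hginj : ∀ f, Function.Injective (g f) := by
    intro f x y h
    by_cases hx : x.val % 2 = 0 <;> by_cases hy : y.val % 2 = 0 <;>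
      simp only [g, hx, hy, if_true, if_false, e.symm.apply_eq_iff_eq, Sum.inl.injEq, Sum.inr.injEq,
        reduceCtorEq] at h
    · have := congrArg Fin.val h
      simp only [ix] at this
      exact Fin.ext (by omega)
    · have := congrArg Fin.val (hmidinj _ _ _ _ h).1
      simp only [ix] at this
      exact Fin.ext (by omega)
  let φ : (Fin m → Fin k) → Copy (cycleGraph (2 * m)) (blowUpCycle m N e) := fun f =>
    ⟨⟨g f, fun {x y} hxy => by
      rcases (cycleGraph_adj_iff hN).1 hxy with rfl | rfl
      · exact (hstep f y).symm
      · exact hstep f x⟩, hginj f⟩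
  have hφ : ∀ f x, φ f x = g f x := fun _ _ => rfl
  rw [copyCount_eq_card_image_copyToSubgraph]
  calc k ^ m = (Finset.univ : Finset (Fin m → Fin k)).card := by simp
    _ ≤ _ := Finset.card_le_card_of_injOn (fun f => (φ f).toSubgraph)
      (fun f _ => Finset.mem_coe.2 (Finset.mem_image_of_mem _ (Finset.mem_univ _))) ?_
  intro f _ f' _ h
  funext i
  have hmem : e.symm (.inr (mid f i)) ∈ (φ f).toSubgraph.verts := by
    rw [Copy.mem_verts_toSubgraph_iff]
    refine ⟨⟨2 * i.val + 1, by omega⟩, ?_⟩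
    rw [hφ]
    simp only [g, ix]
    rw [if_neg (by omega)]
    congr 3
    exact Fin.ext (by simp only; omega)
  rw [show (φ f).toSubgraph = (φ f').toSubgraph from h, Copy.mem_verts_toSubgraph_iff] at hmem
  obtain ⟨x, hx⟩ := hmem
  rw [hφ] at hx
  by_cases hx2 : x.val % 2 = 0 <;>
    simp only [g, hx2, if_true, if_false, e.symm.apply_eq_iff_eq, Sum.inr.injEq,
        reduceCtorEq] at hx
  obtain ⟨h1, h2⟩ := hmidinj _ _ _ _ hx
  rw [← h2, h1]

end

/-! ### Asymptotics -/

section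

open SimpleGraph

open Classical in
/-- In a planar graph on `n` vertices all but `O(n ^ (m - 1/5))` copies of the `2m`-cycle,
`m = r + 1`, correspond to `m`-sets of vertices whose neighbourhoods among the vertices of degree
above `n ^ (1/5)` form an `m`-cycle. -/
theorem exists_cycle_transversals {V : Type*} [Fintype V] {G : SimpleGraph V} (hG : IsPlanar G)
    {r : ℕ} (hr : 2 ≤ r) (hV : 1 ≤ Fintype.card V) :
    ∃ (S : Finset V) (F : Finset (Finset V)), (∀ X ∈ F, X ⊆ S ∧ X.card = r + 1 ∧
        X.image (G.nbrsIn Sᶜ) ∈ cycleSystem V (r + 1)) ∧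
      (G.copyCount (cycleGraph (2 * (r + 1))) : ℝ) ≤ F.card +
        30 ^ r * 783904 * (Fintype.card V : ℝ) ^ (((r + 1 : ℕ) : ℝ) - 1 / 5) := by
  have hD := hG.isDrawable
  set n := Fintype.card V
  have hn : (1 : ℝ) ≤ n := by exact_mod_cast hV
  set x : ℝ := (n : ℝ) ^ (1 / 5 : ℝ) with hx
  have hx1 : 1 ≤ x := Real.one_le_rpow hn (by norm_num)
  have hx5 : x ^ 5 = n := by
    rw [hx, ← Real.rpow_natCast, ← Real.rpow_mul (by positivity)]
    norm_num
  have hpow : (n : ℝ) ^ (((r + 1 : ℕ) : ℝ) - 1 / 5) = (n : ℝ) ^ r * x ^ 4 := by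
    rw [hx, ← Real.rpow_natCast _ 4, ← Real.rpow_mul (by positivity), ← Real.rpow_natCast,
      ← Real.rpow_add (by positivity)]
    congr 1
    push_cast
    ring
  set k := ⌈x⌉₊
  have hkx : x ≤ k := Nat.le_ceil x
  have hk2 : (k : ℝ) ≤ 2 * x := by
    have := Nat.ceil_lt_add_one (show 0 ≤ x by linarith)
    linarith
  set S : Finset V := Finset.univ.filter fun v => (G.nbrsIn Finset.univ v).card ≤ k with hS
  have hdarts : (G.dartsIn Finset.univ).card ≤ 30 * n := hD.card_dartsIn_le Finset.univ
  -- few vertices have large degree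
  have hB : k * Sᶜ.card ≤ 30 * n := by
    refine le_trans ?_ hdarts
    rw [SimpleGraph.card_dartsIn, mul_comm, ← smul_eq_mul]
    refine (Finset.card_nsmul_le_sum _ (fun v => (G.nbrsIn Finset.univ v).card) _ ?_).trans
      (Finset.sum_le_sum_of_subset (Finset.subset_univ Sᶜ))
    intro v hv
    rw [hS, Finset.mem_compl, Finset.mem_filter] at hv
    simp only [Finset.mem_univ, true_and, not_le] at hv
    exact hv.le
  have hbranch : (G.branchVertices S).card ≤ 870 * Sᶜ.card :=
    hD.card_le_of_three_nbrs
      (Finset.disjoint_of_subset_left (Finset.filter_subset _ _) disjoint_compl_right)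
      (fun t ht => (Finset.mem_filter.1 ht).2)
  have hexc : (G.dartsIn (Sᶜ ∪ G.branchVertices S)).card ≤ 26130 * Sᶜ.card := by
    have h1 := hD.card_dartsIn_le (Sᶜ ∪ G.branchVertices S)
    have h2 := Finset.card_union_le Sᶜ (G.branchVertices S)
    linarith
  obtain ⟨F, hF, hcount⟩ := copyCount_cycleGraph_le G hr k S
    (fun s hs => (Finset.mem_filter.1 hs).2)
  refine ⟨S, F, hF, ?_⟩
  have hcount : (G.copyCount (cycleGraph (2 * (r + 1))) : ℝ) ≤
      (G.dartsIn Finset.univ).card ^ r * (k : ℝ) ^ 2 +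
        (G.dartsIn (Sᶜ ∪ G.branchVertices S)).card * (G.dartsIn Finset.univ).card ^ r + F.card := by
    exact_mod_cast hcount
  have hdarts : ((G.dartsIn Finset.univ).card : ℝ) ≤ 30 * n := by exact_mod_cast hdarts
  have hB : (k : ℝ) * Sᶜ.card ≤ 30 * n := by exact_mod_cast hB
  have hexc : ((G.dartsIn (Sᶜ ∪ G.branchVertices S)).card : ℝ) ≤ 26130 * Sᶜ.card := by
    exact_mod_cast hexc
  have hdr : ((G.dartsIn Finset.univ).card : ℝ) ^ r ≤ 30 ^ r * (n : ℝ) ^ r := by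
    rw [← mul_pow]
    exact pow_le_pow_left₀ (by positivity) hdarts r
  have hBx : (Sᶜ.card : ℝ) ≤ 30 * x ^ 4 := by
    have h1 : x * Sᶜ.card ≤ x * (30 * x ^ 4) := by
      calc x * Sᶜ.card ≤ k * Sᶜ.card := by gcongr
        _ ≤ 30 * n := hB
        _ = x * (30 * x ^ 4) := by rw [← hx5]; ring
    exact le_of_mul_le_mul_left h1 (by linarith)
  have hk4 : (k : ℝ) ^ 2 ≤ 4 * x ^ 4 := by
    have h1 : (k : ℝ) ^ 2 ≤ (2 * x) ^ 2 := by gcongr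
    have h2 : x ^ 2 ≤ x ^ 4 := pow_le_pow_right₀ hx1 (by norm_num)
    linarith
  rw [hpow]
  have t1 : ((G.dartsIn Finset.univ).card : ℝ) ^ r * (k : ℝ) ^ 2
      ≤ (30 ^ r * (n : ℝ) ^ r) * (4 * x ^ 4) := by gcongr
  have t2 : ((G.dartsIn (Sᶜ ∪ G.branchVertices S)).card : ℝ) * (G.dartsIn Finset.univ).card ^ r
      ≤ (26130 * (30 * x ^ 4)) * (30 ^ r * (n : ℝ) ^ r) := by
    refine mul_le_mul (hexc.trans ?_) hdr (by positivity) (by positivity)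
    gcongr
  linarith

theorem maxPlanarCopies_le {W : Type*} {n : ℕ} {H : SimpleGraph W} {b : ℝ} (hb : 0 ≤ b)
    (h : ∀ G : SimpleGraph (Fin n), IsPlanar G → (G.copyCount H : ℝ) ≤ b) :
    (maxPlanarCopies n H : ℝ) ≤ b := by
  classical
  rw [← Nat.le_floor_iff hb]
  refine Finset.sup_le fun G hG => ?_
  rw [Nat.le_floor_iff hb]
  exact h G (Finset.mem_filter.1 hG).2

theorem copyCount_le_maxPlanarCopies {W : Type*} {n : ℕ} {H : SimpleGraph W}
    {G : SimpleGraph (Fin n)} (hG : IsPlanar G) : G.copyCount H ≤ maxPlanarCopies n H := by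
  classical
  exact Finset.le_sup (f := fun G : SimpleGraph (Fin n) => G.copyCount H)
    (Finset.mem_filter.2 ⟨Finset.mem_univ _, hG⟩)

/-- Upper bound for even cycles from a bound `c` for the Lagrange polynomial of `m`-cycles. -/
theorem maxPlanarCopies_cycleGraph_le_of_lagrangePoly {r : ℕ} (hr : 2 ≤ r) {c : ℝ} (hc : 0 ≤ c)
    (h : ∀ (n : ℕ) (w : Finset (Fin n) → ℝ), (∀ e, 0 ≤ w e) →
      lagrangePoly (cycleSystem (Fin n) (r + 1)) w ≤ c * (∑ e, w e) ^ (r + 1)) {n : ℕ} (hn : 1 ≤ n) :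
    (maxPlanarCopies n (cycleGraph (2 * (r + 1))) : ℝ) ≤ c * (n : ℝ) ^ (r + 1) +
      30 ^ r * 783904 * (n : ℝ) ^ (((r + 1 : ℕ) : ℝ) - 1 / 5) := by
  refine maxPlanarCopies_le (by positivity) fun G hG => ?_
  obtain ⟨S, F, hF, hcount⟩ := exists_cycle_transversals hG hr (by simpa using hn)
  simp only [Fintype.card_fin] at hcount
  refine hcount.trans (add_le_add_left ?_ _)
  have h1 := card_transversals_le_lagrangePoly S (G.nbrsIn Sᶜ)
    (fun H => card_of_mem_cycleSystem (V := Fin n) (m := r + 1) (by omega)) F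
    (fun X hX => by
      have := hF X hX
      convert this)
  refine h1.trans ((h n _ fun _ => Nat.cast_nonneg _).trans ?_)
  gcongr
  rw [← Nat.cast_sum, ← Finset.card_eq_sum_card_fiberwise (fun _ _ => Finset.mem_univ _)]
  exact_mod_cast (Finset.card_le_univ S).trans_eq (Fintype.card_fin n)

theorem maxPlanarCopies_cycleGraph_le_choose {r : ℕ} (hr : 2 ≤ r) {n : ℕ} (hn : 1 ≤ n) :
    (maxPlanarCopies n (cycleGraph (2 * (r + 1))) : ℝ) ≤
      (n : ℝ) ^ (r + 1) / (Nat.factorial (r + 1) : ℝ) +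
      30 ^ r * 783904 * (n : ℝ) ^ (((r + 1 : ℕ) : ℝ) - 1 / 5) := by
  refine maxPlanarCopies_le (by positivity) fun G hG => ?_
  obtain ⟨S, F, hF, hcount⟩ := exists_cycle_transversals hG hr (by simpa using hn)
  simp only [Fintype.card_fin] at hcount
  refine hcount.trans (add_le_add_left ?_ _)
  have h1 : F.card ≤ n.choose (r + 1) := by
    have : F ⊆ (Finset.univ : Finset (Fin n)).powersetCard (r + 1) := fun X hX =>
      Finset.mem_powersetCard.2 ⟨Finset.subset_univ X, (hF X hX).2.1⟩
    have := Finset.card_le_card this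
    rwa [Finset.card_powersetCard, Finset.card_univ, Fintype.card_fin] at this
  calc (F.card : ℝ) ≤ n.choose (r + 1) := by exact_mod_cast h1
    _ ≤ _ := Nat.choose_le_pow_div _ _

theorem le_maxPlanarCopies_cycleGraph {m : ℕ} [NeZero m] (hm : 2 ≤ m)
    (hplanar : ∀ (n N : ℕ) (e : Fin n ≃ Fin m ⊕ Fin N), IsPlanar (blowUpCycle m N e))
    {n : ℕ} (hn : 1 ≤ n) : ((n : ℝ) / m) ^ m - 2 * m * (n : ℝ) ^ ((m : ℝ) - 1 / 5)
      ≤ maxPlanarCopies n (cycleGraph (2 * m)) := by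
  have hn1 : (1 : ℝ) ≤ n := by exact_mod_cast hn
  have hm2 : (2 : ℝ) ≤ m := by exact_mod_cast hm
  have herr : (n : ℝ) ^ (m - 1) ≤ (n : ℝ) ^ ((m : ℝ) - 1 / 5) := by
    rw [← Real.rpow_natCast]
    refine Real.rpow_le_rpow_of_exponent_le hn1 ?_
    rw [Nat.cast_sub (by omega)]
    push_cast
    linarith
  rcases lt_or_ge n m with hlt | hge
  · have h1 : ((n : ℝ) / m) ^ m ≤ 1 := by
      refine pow_le_one₀ (by positivity) ?_
      rw [div_le_one (by positivity)]
      exact_mod_cast hlt.le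
    have h2 : (1 : ℝ) ≤ (n : ℝ) ^ (m - 1) := one_le_pow₀ hn1
    have h3 : (0 : ℝ) ≤ maxPlanarCopies n (cycleGraph (2 * m)) := Nat.cast_nonneg _
    nlinarith
  set k := (n - m) / m
  have hk1 : m * k ≤ n - m := Nat.mul_div_le _ _
  have hk2 : n - m < m * (k + 1) := Nat.lt_mul_div_succ _ (by omega)
  let e : Fin n ≃ Fin m ⊕ Fin (n - m) := (finCongr (by omega)).trans finSumFinEquiv.symm
  have hcopies := (pow_le_copyCount_blowUpCycle hm hk1 e).trans
    (copyCount_le_maxPlanarCopies (hplanar n _ e))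
  have hcopies : (k : ℝ) ^ m ≤ maxPlanarCopies n (cycleGraph (2 * m)) := by exact_mod_cast hcopies
  refine le_trans ?_ hcopies
  set a : ℝ := (n : ℝ) / m
  have ha0 : 0 < a := by positivity
  have han : a ≤ n := div_le_self (by positivity) (by linarith)
  have hak : a - k ≤ 2 := by
    have h1 : n < m * (k + 2) := by
      rw [show m * (k + 2) = m * (k + 1) + m by ring]
      omega
    have h2 : (n : ℝ) ≤ (k + 2) * m := by
      rw [mul_comm]
      exact_mod_cast h1.le
    have h3 : a ≤ k + 2 := (div_le_iff₀ (by positivity)).2 h2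
    linarith
  -- Bernoulli's inequality at `k / a`
  have h1 : 1 + m * ((k : ℝ) / a - 1) ≤ (1 + ((k : ℝ) / a - 1)) ^ m :=
    one_add_mul_le_pow (by have : 0 ≤ (k : ℝ) / a := by positivity
                           linarith) m
  rw [add_sub_cancel, div_pow, le_div_iff₀ (by positivity)] at h1
  have h2 : (1 + m * ((k : ℝ) / a - 1)) * a ^ m = a ^ m - m * (a - k) * a ^ (m - 1) := by
    obtain ⟨q, rfl⟩ := Nat.exists_eq_add_of_le' (show 1 ≤ m by omega)
    rw [Nat.add_sub_cancel, pow_succ]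
    field_simp
    ring
  rw [h2] at h1
  have h3 : m * (a - k) * a ^ (m - 1) ≤ m * 2 * (n : ℝ) ^ (m - 1) := by gcongr
  nlinarith

end

theorem theorem2 :
    (∃ C : ℝ, ∀ n : ℕ, 1 ≤ n →
      |(maxPlanarCopies n (SimpleGraph.cycleGraph 6) : ℝ) - ((n : ℝ) / 3) ^ 3|
        ≤ C * (n : ℝ) ^ (3 - 1 / 5 : ℝ)) ∧
    (∃ C : ℝ, ∀ n : ℕ, 1 ≤ n →
      |(maxPlanarCopies n (SimpleGraph.cycleGraph 8) : ℝ) - ((n : ℝ) / 4) ^ 4|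
        ≤ C * (n : ℝ) ^ (4 - 1 / 5 : ℝ)) ∧
    (∀ m : ℕ, 5 ≤ m → ∃ C : ℝ, ∀ n : ℕ, 1 ≤ n →
      (maxPlanarCopies n (SimpleGraph.cycleGraph (2 * m)) : ℝ)
        ≤ (n : ℝ) ^ m / (Nat.factorial m : ℝ) + C * (n : ℝ) ^ ((m : ℝ) - 1 / 5)) := by
  refine ⟨⟨30 ^ 2 * 783904, fun n hn => ?_⟩, ⟨30 ^ 3 * 783904, fun n hn => ?_⟩, fun m hm => ?_⟩
  · have hup := maxPlanarCopies_cycleGraph_le_of_lagrangePoly (r := 2) (c := 1 / 27) le_rfl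
      (by norm_num) (fun _ _ hw => lagrangePoly_triangles_le hw) hn
    have hlow := le_maxPlanarCopies_cycleGraph (m := 3) (by norm_num)
      (fun _ _ e => isPlanar_blowUpCycle_three e) hn
    have h0 : (0 : ℝ) ≤ (n : ℝ) ^ (3 - 1 / 5 : ℝ) := by positivity
    norm_num only at hup hlow h0 ⊢
    rw [abs_le]
    constructor <;> linarith
  · have hup := maxPlanarCopies_cycleGraph_le_of_lagrangePoly (r := 3) (c := 1 / 256) (by norm_num)
      (by norm_num) (fun _ _ hw => lagrangePoly_fourCycles_le hw) hn
    have hlow := le_maxPlanarCopies_cycleGraph (m := 4) (by norm_num)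
      (fun _ _ e => isPlanar_blowUpCycle_four e) hn
    have h0 : (0 : ℝ) ≤ (n : ℝ) ^ (4 - 1 / 5 : ℝ) := by positivity
    norm_num only at hup hlow h0 ⊢
    rw [abs_le]
    constructor <;> linarith
  · obtain ⟨r, rfl⟩ := Nat.exists_eq_add_of_le' (show 1 ≤ m by omega)
    exact ⟨30 ^ r * 783904, fun n hn => maxPlanarCopies_cycleGraph_le_choose (by omega) hn⟩
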